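/- Let $M$ be a smooth finite-dimensional (Hausdorff) manifold, $X$ a smooth vector field on $M$ and $\mathcal V\subset TM$ a smooth distribution of rank $m$. Put $\mathcal D=\mathcal V+[X,\mathcal V]$, the distribution spanned by the local sections $V$ of $\mathcal V$ and their Lie brackets $[X,V]$. Assume that the pair $(X,\mathcal V)$ is regular, i.e. $X(x)\ne0$ and $\dim\mathcal D(x)=2m$ for all $x\in M$, and $[X,\mathcal D]\subset\mathcal D$. The following objects are determined by $(X,\mathcal V)$. (a) If $(V_1,\dots,V_m)$ is a smooth local frame of $\mathcal V$, write $[X,[X,V_j]]=\sum_i (H_0)^i_jV_i+\sum_i(H_1)^i_j[X,V_i]$. The curvature operator $K_x:\mathcal V(x)\to\mathcal V(x)$ is the endomorphism whose matrix in the basis $(V_i(x))$ is $-H_0+\tfrac12X(H_1)-\tfrac14H_1^2$ at $x$, where $X(H_1)$ is the matrix of derivatives along $X$ of the entries of $H_1$; it does not depend on the frame. (b) A local section $V$ of $\mathcal V$ is normal if $[X,[X,V]]\in\mathcal V$. The horizontal distribution $\mathcal H$ is spanned by the brackets $[X,V]$ with $V$ normal; one has $\mathcal D=\mathcal V\oplus\mathcal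 H$. The covariant derivative of a section $Y$ of $\mathcal V$ is $D_XY=\pi_{\mathcal V}[X,Y]$, where $\pi_{\mathcal V}:\mathcal D\to\mathcal V$ is the projection along $\mathcal H$. Let $c:[0,T]\to M$ be an integral curve of $X$. An invariant metric on $\mathcal V$ along $c$ is a positive definite scalar product $g$ on the spaces $\mathcal V(c(t))$, $t\in[0,T]$, such that $\frac{d}{dt}g(Y,Z)=g(D_XY,Z)+g(Y,D_XZ)$ along $c$ for all local sections $Y,Z$ of $\mathcal V$. The directional curvature is $k(v)=g(Kv,v)/g(v,v)$ for $0\neq v\in\mathcal V(c(t))$. A time $t^*\in(0,T]$ is a conjugate time along $c$ if $\exp(t^*X)_*\mathcal V(c(0))\cap\mathcal V(c(t^*))\ne\{0\}$, where $\exp(tX)$ denotes the local flow of $X$. Theorem. Let $g$ be an invariant metric on $\mathcal V$ along $c$ and let $\lambda\in\mathbb R$. The estimates $$g(Kv,v)\le\lambda\, g(v,v)\quad\text{for all } v\in\mathcal V(c(t)),\ t\in[0,T],$$ and $$k(v)\le\lambda\quad\text{for all } v\in\mathcal V(c(t))\setminus\{0\},\ t\in[0,T],$$ are equivalent. If they hold,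 then there are no conjugate times in $(0,T]$ if $\lambda\le0$, and there are no conjugate times in $(0,\min\{T,\pi/\sqrt\lambda\})$ if $\lambda>0$. -/

import Mathlib

open scoped Manifold ContDiff Matrix
open Set

noncomputable section

namespace DynPair

variable {E : Type*} [NormedAddCommGroup E] [NormedSpace ℝ E]
  {M : Type*} [TopologicalSpace M] [ChartedSpace E M] [IsManifold 𝓘(ℝ, E) ∞ M]

/-- A (not necessarily smooth) vector field on `M`. -/
abbrev VField (E : Type*) [NormedAddCommGroup E] [NormedSpace ℝ E]
    (M : Type*) [TopologicalSpace M] [ChartedSpace E M] : Type _ :=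
  ∀ x : M, TangentSpace 𝓘(ℝ, E) x

/-- A field of tangent subspaces on `M` (a priori of varying dimension and not smooth). -/
abbrev PlaneField (E : Type*) [NormedAddCommGroup E] [NormedSpace ℝ E]
    (M : Type*) [TopologicalSpace M] [ChartedSpace E M] : Type _ :=
  ∀ x : M, Submodule ℝ (TangentSpace 𝓘(ℝ, E) x)

/-- The vector field `Y` is `C^∞` on the set `U`. -/
def SmoothOn (Y : VField E M) (U : Set M) : Prop :=
  ContMDiffOn 𝓘(ℝ, E) 𝓘(ℝ, E).tangent ∞
    (fun y => (⟨y, Y y⟩ : TangentBundle 𝓘(ℝ, E) M)) U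

/-- The Lie bracket `[X, Y]` of vector fields on `M`. -/
abbrev bracket (X Y : VField E M) : VField E M :=
  fun x => VectorField.mlieBracket 𝓘(ℝ, E) X Y x

/-- `Y` is, on some open neighbourhood of `x`, a smooth section of the plane field `Δ`. -/
def IsLocalSection (Δ : PlaneField E M) (Y : VField E M) (x : M) : Prop :=
  ∃ U : Set M, IsOpen U ∧ x ∈ U ∧ SmoothOn Y U ∧ ∀ y ∈ U, Y y ∈ Δ y

/-- `W = (W_1, …, W_m)` is a smooth frame of `V` on the open set `U`. -/
structure IsFrameOn {m : ℕ} (V : PlaneField E M) (W : Fin m → VField E M) (U : Set M) :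
    Prop where
  isOpen : IsOpen U
  smooth : ∀ i, SmoothOn (W i) U
  linearIndependent : ∀ y ∈ U, LinearIndependent ℝ (fun i => W i y)
  span_eq : ∀ y ∈ U, Submodule.span ℝ (range fun i => W i y) = V y

/-- `V` is a smooth distribution of rank `m`. -/
def IsDistribution (m : ℕ) (V : PlaneField E M) : Prop :=
  ∀ x : M, ∃ (U : Set M) (W : Fin m → VField E M), x ∈ U ∧ IsFrameOn V W U

/-- `D = V + [X, V]`. -/
def derived (X : VField E M) (V : PlaneField E M) : PlaneField E M := fun x =>
  V x ⊔ Submodule.span ℝ {u | ∃ W : VField E M, IsLocalSection V W x ∧ u = bracket X W x}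

/-- `(X, V)` is a regular dynamic pair on `M`, with `V` of rank `m`. -/
structure IsRegularPair (m : ℕ) (X : VField E M) (V : PlaneField E M) : Prop where
  smooth : SmoothOn X univ
  distribution : IsDistribution m V
  ne_zero : ∀ x, X x ≠ 0
  rank : ∀ x, Module.finrank ℝ (derived X V x) = 2 * m
  invariant : ∀ (x : M) (Y : VField E M),
    IsLocalSection (derived X V) Y x → bracket X Y x ∈ derived X V x

/-- `[X,[X,W_j]] = ∑ i, (H0)^i_j W_i + ∑ i, (H1)^i_j [X,W_i]` on `U`, with matrices `H0`, `H1`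
of smooth functions on `U` (row index `i`, column index `j`). -/
structure AreStructureMatrices {m : ℕ} (X : VField E M) (W : Fin m → VField E M)
    (H0 H1 : M → Matrix (Fin m) (Fin m) ℝ) (U : Set M) : Prop where
  smooth_zero : ∀ i j, ContMDiffOn 𝓘(ℝ, E) 𝓘(ℝ, ℝ) ∞ (fun y => H0 y i j) U
  smooth_one : ∀ i j, ContMDiffOn 𝓘(ℝ, E) 𝓘(ℝ, ℝ) ∞ (fun y => H1 y i j) U
  eq : ∀ y ∈ U, ∀ j, bracket X (bracket X (W j)) y =
    ∑ i, H0 y i j • W i y + ∑ i, H1 y i j • bracket X (W i) y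

/-- The matrix `X(H)` of derivatives along `X` of the entries of `H`, at the point `x`. -/
def derivAlong {m : ℕ} (X : VField E M) (H : M → Matrix (Fin m) (Fin m) ℝ) (x : M) :
    Matrix (Fin m) (Fin m) ℝ :=
  Matrix.of fun i j => mfderiv 𝓘(ℝ, E) 𝓘(ℝ, ℝ) (fun y => H y i j) x (X x)

/-- The curvature matrix `K = - H0 + X(H1) / 2 - H1 ^ 2 / 4`, at the point `x`. -/
def curvatureMatrix {m : ℕ} (X : VField E M) (H0 H1 : M → Matrix (Fin m) (Fin m) ℝ) (x : M) :
    Matrix (Fin m) (Fin m) ℝ :=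
  -H0 x + (1 / 2 : ℝ) • derivAlong X H1 x - (1 / 4 : ℝ) • (H1 x * H1 x)

/-- `w = K_x v`, where `K_x` is the endomorphism of `V x` given by the curvature matrix in some
frame of `V` near `x`. -/
def IsCurvatureVector (m : ℕ) (X : VField E M) (V : PlaneField E M) (x : M)
    (v w : TangentSpace 𝓘(ℝ, E) x) : Prop :=
  ∃ (U : Set M) (W : Fin m → VField E M) (H0 H1 : M → Matrix (Fin m) (Fin m) ℝ)
    (a : Fin m → ℝ), x ∈ U ∧ IsFrameOn V W U ∧ AreStructureMatrices X W H0 H1 U ∧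
      v = ∑ i, a i • W i x ∧ w = ∑ i, (curvatureMatrix X H0 H1 x *ᵥ a) i • W i x

open Classical in
/-- The curvature operator `K_x`, evaluated at `v ∈ V x`. For a regular pair the vector `w` below
exists and is unique, since curvature matrices in different frames are conjugate. The value at
`v ∉ V x` is irrelevant. -/
def curvature (m : ℕ) (X : VField E M) (V : PlaneField E M) (x : M)
    (v : TangentSpace 𝓘(ℝ, E) x) : TangentSpace 𝓘(ℝ, E) x :=
  if h : ∃ w, IsCurvatureVector m X V x v w then h.choose else 0

/-- A smooth local section `W` of `V` which is normal at the point `x`: `[X,[X,W]](x) ∈ V(x)`.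
A local section is normal if it is normal at every point of its domain. -/
def IsNormalAt (X : VField E M) (V : PlaneField E M) (W : VField E M) (x : M) : Prop :=
  IsLocalSection V W x ∧ bracket X (bracket X W) x ∈ V x

/-- The horizontal space at `x`, spanned by the brackets `[X, W](x)` of sections normal at `x`.
If `W` is normal at `x` then `[X, W](x)` depends on `W(x)` only, so that this is the span of
`[X, V_1](x), …, [X, V_m](x)` for any normal frame `V_1, …, V_m` near `x`. -/
def horizontal (X : VField E M) (V : PlaneField E M) : PlaneField E M := fun x =>
  Submodule.span ℝ {u | ∃ W : VField E M, IsNormalAt X V W x ∧ u = bracket X W x}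

open Classical in
/-- The projection of `D = V ⊕ H` onto `V`, evaluated at `u ∈ D x`: the unique `v ∈ V x` with
`u - v` horizontal. The value at `u ∉ D x` is irrelevant. -/
def verticalPart (X : VField E M) (V : PlaneField E M) (x : M)
    (u : TangentSpace 𝓘(ℝ, E) x) : TangentSpace 𝓘(ℝ, E) x :=
  if h : ∃ v, v ∈ V x ∧ u - v ∈ horizontal X V x then h.choose else 0

/-- The covariant derivative `D_X Y = π_V [X, Y]` of a section `Y` of `V`. -/
def covDeriv (X : VField E M) (V : PlaneField E M) (Y : VField E M) : VField E M :=
  fun x => verticalPart X V x (bracket X Y x)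

/-- `g` is a positive definite metric on `V` along `c : [0,T] → M` which is invariant:
`X(g(Y,Z)) = g(D_X Y, Z) + g(Y, D_X Z)` along `c`, for all local sections `Y`, `Z` of `V`.
Only the restriction of `g t` to `V (c t)`, for `t ∈ [0,T]`, matters. -/
structure IsInvariantMetric (X : VField E M) (V : PlaneField E M) (c : ℝ → M) (T : ℝ)
    (g : ∀ t : ℝ, LinearMap.BilinForm ℝ (TangentSpace 𝓘(ℝ, E) (c t))) : Prop where
  symm : ∀ t ∈ Icc 0 T, ∀ u ∈ V (c t), ∀ v ∈ V (c t), g t u v = g t v u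
  pos : ∀ t ∈ Icc 0 T, ∀ v ∈ V (c t), v ≠ 0 → 0 < g t v v
  invariant : ∀ t ∈ Icc 0 T, ∀ Y Z : VField E M,
    IsLocalSection V Y (c t) → IsLocalSection V Z (c t) →
    HasDerivWithinAt (fun s => g s (Y (c s)) (Z (c s)))
      (g t (covDeriv X V Y (c t)) (Z (c t)) + g t (Y (c t)) (covDeriv X V Z (c t)))
      (Icc 0 T) t

/-- The curvature `k(v) = g(K v, v) / g(v, v)` in direction `v ∈ V (c t)`. -/
def directionalCurvature (m : ℕ) (X : VField E M) (V : PlaneField E M) (c : ℝ → M)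
    (g : ∀ t : ℝ, LinearMap.BilinForm ℝ (TangentSpace 𝓘(ℝ, E) (c t))) (t : ℝ)
    (v : TangentSpace 𝓘(ℝ, E) (c t)) : ℝ :=
  g t (curvature m X V (c t) v) v / g t v v

/-- `Φ` is the smooth local flow `(s, y) ↦ exp(sX)(y)` of `X` on an open neighbourhood
`J × U` of `[0,t] × {x₀}`. -/
def IsLocalFlow (X : VField E M) (x₀ : M) (t : ℝ) (Φ : ℝ → M → M) : Prop :=
  ∃ (J : Set ℝ) (U : Set M), IsOpen J ∧ Icc 0 t ⊆ J ∧ IsOpen U ∧ x₀ ∈ U ∧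
    ContMDiffOn (𝓘(ℝ, ℝ).prod 𝓘(ℝ, E)) 𝓘(ℝ, E) ∞ (fun p : ℝ × M => Φ p.1 p.2) (J ×ˢ U) ∧
    ∀ y ∈ U, Φ 0 y = y ∧ IsMIntegralCurveOn (fun s => Φ s y) X J

/-- `t > 0` is a conjugate time along the integral curve `c` of `X`:
`exp(tX)_* V(x₀) ∩ V(c(t)) ≠ {0}`, where `x₀ = c(0)`. Here `exp(tX)` is the (locally unique) flow
map near `x₀`, and `Φ t (c 0) = c t` by uniqueness of integral curves. -/
def IsConjugateTime (X : VField E M) (V : PlaneField E M) (c : ℝ → M) (t : ℝ) : Prop :=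
  0 < t ∧ ∃ Φ : ℝ → M → M, IsLocalFlow X (c 0) t Φ ∧
    (V (c 0)).map (mfderiv 𝓘(ℝ, E) 𝓘(ℝ, E) (Φ t) (c 0)).toLinearMap ⊓ V (Φ t (c 0)) ≠ ⊥

end DynPair

end

/-! Everything is pulled back to the fixed vector space T_{c(0)}M by the inverse differential of the
flow. A field Y along c becomes a curve in that space whose derivative is the pulled back bracket
[X,Y] (`IsFlowBox.hasDerivAt_pull`). So V turns into a curve of subspaces L(t), and a frame of V
into a basis w of L with w' = u and u' = w H₀ + u H₁. A time τ is conjugate when some v ≠ 0 lies in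
both L(0) and L(τ).

Write the constant vector v as w a + u b and put B = w b, P = -w (a + ½ H₁ b). Then B is the
vertical vector whose horizontal lift is the horizontal part of v, and -P is the vertical part of v.
Constancy of v becomes the Jacobi equation D B = P, D P = -K B for the connection with matrix ½ H₁
(`exists_jacobi_evolution`), and v ∈ L(t) forces B(t) = 0. For an invariant metric, (|B|²)' = 2⟨P,B⟩
and ⟨P,B⟩' = |P|² - ⟨KB,B⟩ ≥ |P|² - λ|B|². Sturm comparison with a cosine
(`eqOn_zero_of_comparison`) gives B = 0 on [0,τ] when √λ τ < π; then P(0) = 0 as well, and v = 0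
(`eq_zero_of_mem_endpoints`).

Frames exist only locally. `exists_change_of_frame` and `IsJacobiPairIn.change` show that K, B and P
do not depend on them, and local statements are continued over [0,τ] by uniqueness for linear
differential equations and connectedness. On the manifold, `covDeriv_frame` and `curvature_comb`
identify the connection and the curvature with the matrices ½ H₁ and K. -/

open Filter Topology

namespace DynPair

/-! ### Smooth dependence of coefficients on a linearly independent family -/

section Coefficients

variable {ι E : Type*} [Fintype ι] [NormedAddCommGroup E] [NormedSpace ℝ E] [FiniteDimensional ℝ E]

/-- The coefficients of a vector with respect to a linearly independent family can be extracted by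
a map depending smoothly on the family and on the vector. -/
theorem exists_smooth_coefficients {A₀ : ι → E} (h : LinearIndependent ℝ A₀) :
    ∃ φ : (ι → E) × E → ι → ℝ, ∀ᶠ A in 𝓝 A₀,
      (∀ s, ContDiffAt ℝ ∞ φ (A, s)) ∧ ∀ c : ι → ℝ, φ (A, ∑ i, c i • A i) = c := by
  classical
  -- With P a left inverse of the combination map of A₀, the operator Q A = P ∘ (combination map of
  -- A) is 1 at A₀, hence invertible nearby, and (Q A)⁻¹ (P s) recovers the coefficients of s.
  obtain ⟨P, hP⟩ := LinearMap.exists_leftInverse_of_injective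
    (Fintype.linearCombination ℝ A₀) (LinearMap.ker_eq_bot.2
      (linearIndependent_iff_injective_fintypeLinearCombination.1 h))
  let P' : E →L[ℝ] (ι → ℝ) := LinearMap.toContinuousLinearMap P
  let Q : (ι → E) → ((ι → ℝ) →L[ℝ] (ι → ℝ)) := fun A =>
    ∑ i, (ContinuousLinearMap.proj (R := ℝ) (φ := fun _ : ι => ℝ) i).smulRight (P' (A i))
  have hQ : ∀ A c, Q A c = P' (∑ i, c i • A i) := by
    intro A c
    simp [Q, map_sum]
  have hQc : ContDiff ℝ ∞ Q := by
    refine ContDiff.sum fun i _ => ?_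
    have : ContDiff ℝ ∞ fun A : ι → E => P' (A i) := by fun_prop
    exact (ContinuousLinearMap.smulRightL ℝ (ι → ℝ) (ι → ℝ)
      (ContinuousLinearMap.proj (R := ℝ) (φ := fun _ : ι => ℝ) i)).contDiff.comp this
  have hQ0 : Q A₀ = 1 := by
    ext1 c
    rw [hQ]
    exact LinearMap.congr_fun hP c
  have hunit : ∀ᶠ A in 𝓝 A₀, IsUnit (Q A) := by
    have : {T : (ι → ℝ) →L[ℝ] (ι → ℝ) | IsUnit T} ∈ 𝓝 (Q A₀) :=
      Units.isOpen.mem_nhds (by rw [hQ0]; exact isUnit_one)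
    exact hQc.continuous.continuousAt this
  refine ⟨fun p => Ring.inverse (Q p.1) (P' p.2), ?_⟩
  filter_upwards [hunit] with A hA
  refine ⟨fun s => ?_, fun c => ?_⟩
  · obtain ⟨a, ha⟩ := hA
    have h1 : ContDiffAt ℝ ∞ (fun p : (ι → E) × E => Ring.inverse (Q p.1)) (A, s) := by
      have h2 : ContDiffAt ℝ ∞ Ring.inverse (Q A) := by
        rw [← ha]; exact contDiffAt_ringInverse ℝ a
      exact h2.comp (A, s) (f := fun p : (ι → E) × E => Q p.1)
        (hQc.comp contDiff_fst).contDiffAt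
    exact h1.clm_apply (P'.contDiff.comp contDiff_snd).contDiffAt
  · rw [← hQ, ← mul_apply_eq_comp, Ring.inverse_mul_cancel _ hA]
    rfl

end Coefficients

/-! ### Scalar comparison, linear differential equations, propagation along an interval -/

section Scalar

/-- A Sturm type comparison: `f = |B|²`, `h = ⟨DB, B⟩` and `e = |DB|²` for a field `B` with
`⟨D²B, B⟩ ≥ -lam |B|²` vanishing at both ends of an interval shorter than `π / √lam`. -/
theorem eqOn_zero_of_comparison {f h e h' : ℝ → ℝ} {τ lam : ℝ} (hlam : 0 ≤ lam)
    (hτ : √lam * τ < Real.pi)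
    (hf : ∀ t ∈ Icc 0 τ, HasDerivWithinAt f (2 * h t) (Icc 0 τ) t)
    (hh : ∀ t ∈ Icc 0 τ, HasDerivWithinAt h (h' t) (Icc 0 τ) t)
    (hh' : ∀ t ∈ Icc 0 τ, e t - lam * f t ≤ h' t)
    (hsq : ∀ t ∈ Icc 0 τ, ∀ r : ℝ, 0 ≤ e t - 2 * r * h t + r ^ 2 * f t)
    (hf0 : f 0 = 0) (hh0 : h 0 = 0) (hfτ : f τ = 0) (hpos : ∀ t ∈ Icc 0 τ, 0 ≤ f t) :
    ∀ t ∈ Icc 0 τ, f t = 0 := by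
  rcases lt_or_ge τ 0 with hτ0 | hτ0
  · intro t ht; exact absurd (ht.1.trans ht.2) (not_le.2 hτ0)
  set k := √lam with hk
  have hk0 : 0 ≤ k := Real.sqrt_nonneg _
  have hk2 : k ^ 2 = lam := Real.sq_sqrt hlam
  -- The comparison function solves s'' = -lam s. Centring it at τ / 2 makes it positive on the
  -- closed interval, because √lam τ < π.
  let s : ℝ → ℝ := fun t => Real.cos (k * (t - τ / 2))
  let s' : ℝ → ℝ := fun t => -(k * Real.sin (k * (t - τ / 2)))
  have hs : ∀ t, HasDerivAt s (s' t) t := by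
    intro t
    have h1 : HasDerivAt (fun t : ℝ => k * (t - τ / 2)) k t := by
      simpa using ((hasDerivAt_id t).sub_const (τ / 2)).const_mul k
    refine h1.cos.congr_deriv ?_
    simp only [s']; ring
  have hs' : ∀ t, HasDerivAt s' (-(lam * s t)) t := by
    intro t
    have h1 : HasDerivAt (fun t : ℝ => k * (t - τ / 2)) k t := by
      simpa using ((hasDerivAt_id t).sub_const (τ / 2)).const_mul k
    refine ((h1.sin).const_mul k).neg.congr_deriv ?_
    simp only [s, ← hk2]; ring
  have hspos : ∀ t ∈ Icc 0 τ, 0 < s t := by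
    intro t ht
    apply Real.cos_pos_of_mem_Ioo
    constructor
    · nlinarith [ht.1, ht.2, Real.pi_pos]
    · nlinarith [ht.1, ht.2, Real.pi_pos]
  -- q = s² (f / s²)'. Its derivative is at least 2 (e - 2 r h + r² f) with r = s' / s, which is
  -- nonnegative by `hsq`; so q increases from q(0) = 0.
  let q : ℝ → ℝ := fun t => 2 * h t - 2 * f t * (s' t / s t)
  have hq : ∀ t ∈ Icc 0 τ, HasDerivWithinAt q
      (2 * h' t - (2 * (2 * h t) * (s' t / s t) +
        2 * f t * ((-(lam * s t) * s t - s' t * s' t) / s t ^ 2))) (Icc 0 τ) t := by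
    intro t ht
    have h1 := ((hf t ht).const_mul 2).mul
      (((hs' t).hasDerivWithinAt (s := Icc 0 τ)).div ((hs t).hasDerivWithinAt) (hspos t ht).ne')
    exact ((hh t ht).const_mul 2).sub h1
  have hqmono : MonotoneOn q (Icc 0 τ) := by
    refine monotoneOn_of_hasDerivWithinAt_nonneg (convex_Icc 0 τ)
      (fun t ht => (hq t ht).continuousWithinAt)
      (fun t ht => (hq t (interior_subset ht)).mono interior_subset) ?_
    intro t ht
    have ht := interior_subset ht
    have h1 := hsq t ht (s' t / s t)
    have h2 := hh' t ht
    have h3 := (hspos t ht).ne'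
    have h4 : (-(lam * s t) * s t - s' t * s' t) / s t ^ 2 = -lam - (s' t / s t) ^ 2 := by
      field_simp
      try ring
    rw [h4]
    nlinarith
  have hq0 : q 0 = 0 := by simp [q, hf0, hh0]
  have hqpos : ∀ t ∈ Icc 0 τ, 0 ≤ q t := by
    intro t ht
    rw [← hq0]
    exact hqmono ⟨le_rfl, hτ0⟩ ht ht.1
  let r : ℝ → ℝ := fun t => f t / s t ^ 2
  have hr : ∀ t ∈ Icc 0 τ, HasDerivWithinAt r (q t / s t ^ 2) (Icc 0 τ) t := by
    intro t ht
    have h3 := (hspos t ht).ne'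
    refine ((hf t ht).div (((hs t).hasDerivWithinAt (s := Icc 0 τ)).pow 2)
      (pow_ne_zero 2 h3)).congr_deriv ?_
    simp only [q, Pi.pow_apply]
    field_simp
    push_cast
    ring
  have hrmono : MonotoneOn r (Icc 0 τ) := by
    refine monotoneOn_of_hasDerivWithinAt_nonneg (convex_Icc 0 τ)
      (fun t ht => (hr t ht).continuousWithinAt)
      (fun t ht => (hr t (interior_subset ht)).mono interior_subset) ?_
    intro t ht
    have := hqpos t (interior_subset ht)
    positivity
  intro t ht
  -- f / s² is increasing and vanishes at τ, so f ≤ 0.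
  have h1 := hrmono ht ⟨hτ0, le_rfl⟩ ht.2
  have h2 : r τ = 0 := by simp [r, hfτ]
  rw [h2] at h1
  have h3 := pow_pos (hspos t ht) 2
  have h4 : f t ≤ 0 := by
    by_contra hcon
    exact absurd h1 (not_le.2 (div_pos (not_le.1 hcon) h3))
  exact le_antisymm h4 (hpos t ht)

/-- A solution of a linear differential equation with locally bounded coefficients which vanishes
at some time near `t₀` vanishes near `t₀`. -/
theorem eventually_eq_zero_of_linear_ode {F : Type*} [NormedAddCommGroup F] [NormedSpace ℝ F]
    {A : ℝ → F →L[ℝ] F} {t₀ : ℝ} (hA : ContinuousAt A t₀) {S : Set ℝ} (hS : S ∈ 𝓝 t₀) :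
    ∃ N ∈ 𝓝 t₀, N ⊆ S ∧ ∀ y : ℝ → F, (∀ t ∈ S, HasDerivAt y (A t (y t)) t) →
      ∀ t₁ ∈ N, y t₁ = 0 → ∀ t ∈ N, y t = 0 := by
  have h1 : ∀ᶠ t in 𝓝 t₀, ‖A t‖ < ‖A t₀‖ + 1 :=
    hA.norm.eventually_lt continuousAt_const (by linarith)
  -- The neighbourhood comes from A and S alone, so that one serves all solutions; later the
  -- solution depends on the time at which it vanishes.
  obtain ⟨ε, hε, hb⟩ := Metric.mem_nhds_iff.1 (inter_mem hS h1)
  refine ⟨Metric.ball t₀ ε, Metric.ball_mem_nhds _ hε, fun t ht => (hb ht).1, ?_⟩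
  intro y hy t₁ ht₁ hy₁
  rw [Real.ball_eq_Ioo] at *
  let K : NNReal := ⟨‖A t₀‖ + 1, by positivity⟩
  have := ODE_solution_unique_of_mem_Ioo (v := fun t x => A t x) (s := fun _ => univ) (K := K)
    (f := y) (g := fun _ => 0) (a := t₀ - ε) (b := t₀ + ε) (t₀ := t₁) ?_ ht₁ ?_ ?_ hy₁
  · exact this
  · intro t ht
    refine ((A t).lipschitz.weaken ?_).lipschitzOnWith
    rw [← NNReal.coe_le_coe]
    exact (hb ht).2.le
  · exact fun t ht => ⟨hy t (hb ht).1, mem_univ _⟩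
  · intro t ht
    simpa using hasDerivAt_const t (0 : F)

/-- A property which is locally constant along `[0, τ]` propagates. -/
theorem propagate {τ : ℝ} {Q : ℝ → Prop}
    (h : ∀ t₀ ∈ Icc 0 τ, ∃ N ∈ 𝓝 t₀, ∀ t₁ ∈ N, ∀ t ∈ N, t₁ ∈ Icc 0 τ → t ∈ Icc 0 τ → Q t₁ → Q t)
    {a b : ℝ} (ha : a ∈ Icc 0 τ) (hb : b ∈ Icc 0 τ) (hQ : Q a) : Q b := by
  refine isPreconnected_Icc.induction₂' (fun x y => Q x → Q y) ?_ ?_ ha hb hQ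
  · intro x hx
    obtain ⟨N, hN, hN'⟩ := h x hx
    filter_upwards [mem_nhdsWithin_of_mem_nhds hN, self_mem_nhdsWithin] with y hy hyI
    exact ⟨hN' _ (mem_of_mem_nhds hN) _ hy hx hyI, hN' _ hy _ (mem_of_mem_nhds hN) hyI hx⟩
  · exact fun x y z _ _ _ hxy hyz h => hyz (hxy h)

end Scalar

/-! ### Calculus of linear combinations -/

section Comb

/-- The linear combination `∑ i, a i • w i` as a linear function of the coefficients. -/
def comb {ι F : Type*} [Fintype ι] [AddCommGroup F] [Module ℝ F] (w : ι → F) :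
    (ι → ℝ) →ₗ[ℝ] F :=
  Fintype.linearCombination ℝ w

theorem comb_apply {ι F : Type*} [Fintype ι] [AddCommGroup F] [Module ℝ F] (w : ι → F)
    (a : ι → ℝ) : comb w a = ∑ i, a i • w i :=
  Fintype.linearCombination_apply ℝ w a

theorem map_comb {ι F F' : Type*} [Fintype ι] [AddCommGroup F] [Module ℝ F] [AddCommGroup F']
    [Module ℝ F'] (T : F →ₗ[ℝ] F') (w : ι → F) (a : ι → ℝ) :
    T (comb w a) = comb (fun i => T (w i)) a := by
  simp [comb_apply]

theorem range_comb {ι F : Type*} [Fintype ι] [AddCommGroup F] [Module ℝ F] (w : ι → F) :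
    LinearMap.range (comb w) = Submodule.span ℝ (range w) :=
  Fintype.range_linearCombination ℝ w

theorem comb_single {ι F : Type*} [Fintype ι] [DecidableEq ι] [AddCommGroup F] [Module ℝ F]
    (w : ι → F) (i : ι) : comb w (Pi.single i 1) = w i := by
  simp [comb]

theorem comb_add_left {ι F : Type*} [Fintype ι] [AddCommGroup F] [Module ℝ F] (w w' : ι → F)
    (a : ι → ℝ) : comb (fun i => w i + w' i) a = comb w a + comb w' a := by
  simp [comb_apply, Finset.sum_add_distrib]

theorem comb_comb {ι κ F : Type*} [Fintype ι] [Fintype κ] [AddCommGroup F] [Module ℝ F]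
    (w : ι → F) (C : Matrix ι κ ℝ) (a : κ → ℝ) :
    comb (fun j => comb w (C.col j)) a = comb w (C *ᵥ a) := by
  simp only [comb_apply, Matrix.mulVec, dotProduct, Finset.smul_sum, Finset.sum_smul, smul_smul,
    Matrix.col_apply]
  rw [Finset.sum_comm]
  simp only [mul_comm]

theorem hasDerivAt_comb {ι E : Type*} [Fintype ι] [NormedAddCommGroup E] [NormedSpace ℝ E]
    {w : ℝ → ι → E} {w' : ι → E} {a : ℝ → ι → ℝ} {a' : ι → ℝ} {t : ℝ}
    (hw : HasDerivAt w w' t) (ha : HasDerivAt a a' t) :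
    HasDerivAt (fun s => comb (w s) (a s)) (comb (w t) a' + comb w' (a t)) t := by
  simp only [comb_apply, ← Finset.sum_add_distrib]
  refine HasDerivAt.fun_sum fun i _ => ?_
  refine ((hasDerivAt_pi.1 ha i).smul (hasDerivAt_pi.1 hw i)).congr_deriv ?_
  rw [add_comm]

theorem hasDerivAt_mulVec {ι κ : Type*} [Finite ι] [Fintype κ] {H : ℝ → Matrix ι κ ℝ}
    {H' : Matrix ι κ ℝ} {a : ℝ → κ → ℝ} {a' : κ → ℝ} {t : ℝ}
    (hH : ∀ i j, HasDerivAt (fun s => H s i j) (H' i j) t) (ha : HasDerivAt a a' t) :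
    HasDerivAt (fun s => H s *ᵥ a s) (H' *ᵥ a t + H t *ᵥ a') t := by
  rw [hasDerivAt_pi]
  intro i
  simp only [Matrix.mulVec, dotProduct, Pi.add_apply, ← Finset.sum_add_distrib]
  exact HasDerivAt.fun_sum fun j _ => (hH i j).mul (hasDerivAt_pi.1 ha j)

end Comb

/-! ### Moving frames in a fixed vector space -/

section MovingFrame

variable {m : ℕ} {E : Type*} [NormedAddCommGroup E] [NormedSpace ℝ E]

/-- `w` is at time `t` a frame of the moving subspace `L`, with derivative `u`, such that `w` and
`u` are jointly independent and satisfy the structure equation `u' = w H₀ + u H₁`, where `H₁` has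
derivative `H₁'`. -/
structure IsMovingFrameAt (L : ℝ → Submodule ℝ E) (w u : ℝ → Fin m → E)
    (H₀ H₁ H₁' : ℝ → Matrix (Fin m) (Fin m) ℝ) (t : ℝ) : Prop where
  deriv_fst : HasDerivAt w (u t) t
  deriv_snd : HasDerivAt u (fun j => comb (w t) ((H₀ t).col j) + comb (u t) ((H₁ t).col j)) t
  eq_zero : ∀ a b, comb (w t) a + comb (u t) b = 0 → a = 0 ∧ b = 0
  range_eq : LinearMap.range (comb (w t)) = L t
  continuousAt_zero : ∀ i j, ContinuousAt (fun s => H₀ s i j) t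
  deriv_one : ∀ i j, HasDerivAt (fun s => H₁ s i j) (H₁' t i j) t

/-- The curvature matrix of a moving frame. -/
noncomputable def movingCurvature (H₀ H₁ H₁' : ℝ → Matrix (Fin m) (Fin m) ℝ) (t : ℝ) :
    Matrix (Fin m) (Fin m) ℝ :=
  -H₀ t + (1 / 2 : ℝ) • H₁' t - (1 / 4 : ℝ) • (H₁ t * H₁ t)

variable {L : ℝ → Submodule ℝ E} {w u : ℝ → Fin m → E}
  {H₀ H₁ H₁' : ℝ → Matrix (Fin m) (Fin m) ℝ} {t t₀ : ℝ}

namespace IsMovingFrameAt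

theorem unique (h : IsMovingFrameAt L w u H₀ H₁ H₁' t) {a b a' b' : Fin m → ℝ}
    (heq : comb (w t) a + comb (u t) b = comb (w t) a' + comb (u t) b') : a = a' ∧ b = b' := by
  have := h.eq_zero (a - a') (b - b') (by
    rw [map_sub, map_sub, ← sub_eq_zero.2 heq]; abel)
  exact ⟨sub_eq_zero.1 this.1, sub_eq_zero.1 this.2⟩

theorem linearIndependent (h : IsMovingFrameAt L w u H₀ H₁ H₁' t) :
    LinearIndependent ℝ (Sum.elim (w t) (u t)) := by
  rw [Fintype.linearIndependent_iff]
  intro g hg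
  rw [Fintype.sum_sum_type] at hg
  have := h.eq_zero (fun i => g (Sum.inl i)) (fun i => g (Sum.inr i)) (by
    rw [comb_apply, comb_apply]; simpa using hg)
  rintro (i | i)
  · exact congrFun this.1 i
  · exact congrFun this.2 i

theorem hasDerivAt_comb_add (h : IsMovingFrameAt L w u H₀ H₁ H₁' t) {a b : ℝ → Fin m → ℝ}
    {a' b' : Fin m → ℝ} (ha : HasDerivAt a a' t) (hb : HasDerivAt b b' t) :
    HasDerivAt (fun s => comb (w s) (a s) + comb (u s) (b s))
      (comb (w t) (a' + H₀ t *ᵥ b t) + comb (u t) (b' + a t + H₁ t *ᵥ b t)) t := by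
  refine ((hasDerivAt_comb h.deriv_fst ha).add (hasDerivAt_comb h.deriv_snd hb)).congr_deriv ?_
  rw [comb_add_left, comb_comb, comb_comb]
  simp only [map_add]
  abel

end IsMovingFrameAt

variable [FiniteDimensional ℝ E]

/-- Coefficients with respect to a moving frame are differentiable. -/
theorem exists_differentiable_coefficients
    (hF : ∀ᶠ t in 𝓝 t₀, IsMovingFrameAt L w u H₀ H₁ H₁' t) {z : ℝ → E}
    (hz : ∀ᶠ t in 𝓝 t₀, DifferentiableAt ℝ z t)
    (hmem : ∀ᶠ t in 𝓝 t₀, ∃ a b, z t = comb (w t) a + comb (u t) b) :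
    ∃ a b : ℝ → Fin m → ℝ, ∀ᶠ t in 𝓝 t₀, z t = comb (w t) (a t) + comb (u t) (b t) ∧
      DifferentiableAt ℝ a t ∧ DifferentiableAt ℝ b t := by
  obtain ⟨φ, hφ⟩ := exists_smooth_coefficients hF.self_of_nhds.linearIndependent
  have hA : ∀ t, IsMovingFrameAt L w u H₀ H₁ H₁' t →
      DifferentiableAt ℝ (fun s => Sum.elim (w s) (u s)) t := by
    intro t ht
    rw [differentiableAt_pi]
    rintro (i | i)
    · exact differentiableAt_pi.1 ht.deriv_fst.differentiableAt i
    · exact differentiableAt_pi.1 ht.deriv_snd.differentiableAt i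
  have hφ' := (hA t₀ hF.self_of_nhds).continuousAt.eventually hφ
  refine ⟨fun t i => φ (Sum.elim (w t) (u t), z t) (Sum.inl i),
    fun t i => φ (Sum.elim (w t) (u t), z t) (Sum.inr i), ?_⟩
  filter_upwards [hF, hz, hmem, hφ'] with t ht hzt ⟨a, b, hab⟩ hφt
  have hd : DifferentiableAt ℝ (fun s => φ (Sum.elim (w s) (u s), z s)) t :=
    ((hφt.1 (z t)).differentiableAt (by simp)).comp t
      (f := fun s => (Sum.elim (w s) (u s), z s)) ((hA t ht).prodMk hzt)
  refine ⟨?_, ?_, ?_⟩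
  · have : φ (Sum.elim (w t) (u t), z t) = Sum.elim a b := by
      rw [← hφt.2 (Sum.elim a b), Fintype.sum_sum_type, hab, comb_apply, comb_apply]
      simp
    simp only [this, Sum.elim_inl, Sum.elim_inr]
    exact hab
  · exact differentiableAt_pi.2 fun i => differentiableAt_pi.1 hd _
  · exact differentiableAt_pi.2 fun i => differentiableAt_pi.1 hd _

/-- The coefficients of a curve in the moving subspace, and of its first two derivatives. -/
theorem exists_section_coefficients
    (hF : ∀ᶠ t in 𝓝 t₀, IsMovingFrameAt L w u H₀ H₁ H₁' t) {y y₁ y₂ : ℝ → E}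
    (hy : ∀ᶠ t in 𝓝 t₀, HasDerivAt y (y₁ t) t) (hy₁ : ∀ᶠ t in 𝓝 t₀, HasDerivAt y₁ (y₂ t) t)
    (hmem : ∀ᶠ t in 𝓝 t₀, y t ∈ L t) :
    ∃ f f₁ f₂ : ℝ → Fin m → ℝ, ∀ᶠ t in 𝓝 t₀, HasDerivAt f (f₁ t) t ∧ HasDerivAt f₁ (f₂ t) t ∧
      y t = comb (w t) (f t) ∧ y₁ t = comb (w t) (f₁ t) + comb (u t) (f t) ∧
      y₂ t = comb (w t) (f₂ t + H₀ t *ᵥ f t) +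
        comb (u t) ((2 : ℝ) • f₁ t + H₁ t *ᵥ f t) := by
  obtain ⟨f, b, hfb⟩ := exists_differentiable_coefficients hF
    (hy.mono fun t ht => ht.differentiableAt) (by
      filter_upwards [hF, hmem] with t ht hyt
      rw [← ht.range_eq] at hyt
      obtain ⟨a, ha⟩ := hyt
      exact ⟨a, 0, by simp [ha]⟩)
  have hyf : ∀ᶠ t in 𝓝 t₀, y t = comb (w t) (f t) := by
    filter_upwards [hF, hmem, hfb] with t ht hyt hft
    rw [← ht.range_eq] at hyt
    obtain ⟨a, ha⟩ := hyt
    have : comb (w t) a + comb (u t) 0 = comb (w t) (f t) + comb (u t) (b t) := by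
      rw [← hft.1, map_zero, add_zero, ha]
    rw [← ha, (ht.unique this).1]
  have hy1f : ∀ᶠ t in 𝓝 t₀, y₁ t = comb (w t) (deriv f t) + comb (u t) (f t) := by
    filter_upwards [hF, hfb, hyf.eventually_nhds, hy] with t ht hft hyt hdy
    exact (hdy.congr_of_eventuallyEq (EventuallyEq.symm hyt)).unique
      (hasDerivAt_comb ht.deriv_fst hft.2.1.hasDerivAt)
  -- Applied to y₁, whose `w`-coefficient is `deriv f`, the same lemma shows that f is twice
  -- differentiable.
  obtain ⟨a, b', hab⟩ := exists_differentiable_coefficients hF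
    (hy₁.mono fun t ht => ht.differentiableAt)
    (hy1f.mono fun t ht => ⟨_, _, ht⟩)
  have haf : ∀ᶠ t in 𝓝 t₀, deriv f t = a t := by
    filter_upwards [hF, hy1f, hab] with t ht h1 h2
    exact (ht.unique (h1.symm.trans h2.1)).1
  refine ⟨f, deriv f, deriv (deriv f), ?_⟩
  filter_upwards [hF, hfb, hyf, hy1f, hy1f.eventually_nhds, hab, haf.eventually_nhds, hy₁] with
    t ht hft h1 h2 h2' hat h3 hdy
  have hd : DifferentiableAt ℝ (deriv f) t := hat.2.1.congr_of_eventuallyEq h3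
  refine ⟨hft.2.1.hasDerivAt, hd.hasDerivAt, h1, h2, ?_⟩
  have := (hdy.congr_of_eventuallyEq (EventuallyEq.symm h2')).unique
    (ht.hasDerivAt_comb_add hd.hasDerivAt hft.2.1.hasDerivAt)
  rw [this, two_smul]

/-- If the second derivative of a curve in the moving subspace lies in this subspace, then its
first derivative is determined by its value. -/
theorem deriv_eq_of_normal
    (hF : ∀ᶠ t in 𝓝 t₀, IsMovingFrameAt L w u H₀ H₁ H₁' t) {y y₁ y₂ : ℝ → E}
    (hy : ∀ᶠ t in 𝓝 t₀, HasDerivAt y (y₁ t) t) (hy₁ : ∀ᶠ t in 𝓝 t₀, HasDerivAt y₁ (y₂ t) t)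
    (hmem : ∀ᶠ t in 𝓝 t₀, y t ∈ L t) (hn : y₂ t₀ ∈ L t₀) :
    ∃ f : Fin m → ℝ,
      y₁ t₀ = comb (u t₀) f - comb (w t₀) ((1 / 2 : ℝ) • (H₁ t₀ *ᵥ f)) := by
  obtain ⟨f, f₁, f₂, hf⟩ := exists_section_coefficients hF hy hy₁ hmem
  obtain ⟨-, -, -, h1, h2⟩ := hf.self_of_nhds
  rw [← hF.self_of_nhds.range_eq] at hn
  obtain ⟨a, ha⟩ := hn
  rw [← ha] at h2
  -- The `u`-coefficient of a vector of L is zero: 2 f₁ + H₁ f = 0.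
  have h4 := (hF.self_of_nhds.unique (a := a) (b := 0)
    ((by rw [map_zero, add_zero] : _ = comb (w t₀) a).trans h2)).2
  refine ⟨f t₀, ?_⟩
  have h5 : f₁ t₀ = -((1 / 2 : ℝ) • (H₁ t₀ *ᵥ f t₀)) := by
    have : (2 : ℝ) • f₁ t₀ = - (H₁ t₀ *ᵥ f t₀) := eq_neg_of_add_eq_zero_left h4.symm
    rw [← smul_neg, ← this, smul_smul]; norm_num
  rw [h1, h5, map_neg]; abel

end MovingFrame

/-! ### Change of frame and conjugation of the curvature matrix -/

section ChangeOfFrame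

variable {m : ℕ} {E : Type*} [NormedAddCommGroup E] [NormedSpace ℝ E] [FiniteDimensional ℝ E]
  {L : ℝ → Submodule ℝ E} {w u ŵ û : ℝ → Fin m → E}
  {H₀ H₁ H₁' Ĥ₀ Ĥ₁ Ĥ₁' : ℝ → Matrix (Fin m) (Fin m) ℝ} {t₀ : ℝ}

/-- Two moving frames of the same moving subspace are related by a matrix `C`, which conjugates
the curvature matrices. -/
theorem exists_change_of_frame
    (hF : ∀ᶠ t in 𝓝 t₀, IsMovingFrameAt L w u H₀ H₁ H₁' t)
    (hG : ∀ᶠ t in 𝓝 t₀, IsMovingFrameAt L ŵ û Ĥ₀ Ĥ₁ Ĥ₁' t) :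
    ∃ C C₁ : Matrix (Fin m) (Fin m) ℝ, (∀ a, comb (ŵ t₀) a = comb (w t₀) (C *ᵥ a)) ∧
      (∀ a, comb (û t₀) a = comb (w t₀) (C₁ *ᵥ a) + comb (u t₀) (C *ᵥ a)) ∧
      (2 : ℝ) • C₁ + H₁ t₀ * C = C * Ĥ₁ t₀ ∧
      movingCurvature H₀ H₁ H₁' t₀ * C = C * movingCurvature Ĥ₀ Ĥ₁ Ĥ₁' t₀ := by
  have hex := fun j => exists_section_coefficients hF (y := fun t => ŵ t j) (y₁ := fun t => û t j)
    (y₂ := fun t => comb (ŵ t) ((Ĥ₀ t).col j) + comb (û t) ((Ĥ₁ t).col j))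
    (hG.mono fun t ht => hasDerivAt_pi.1 ht.deriv_fst j)
    (hG.mono fun t ht => hasDerivAt_pi.1 ht.deriv_snd j)
    (hG.mono fun t ht => by
      classical
      rw [← ht.range_eq]; exact ⟨Pi.single j 1, comb_single _ _⟩)
  choose f f₁ f₂ hf using hex
  have hf := eventually_all.2 hf
  let C : ℝ → Matrix (Fin m) (Fin m) ℝ := fun t => Matrix.of fun i j => f j t i
  let C₁ : ℝ → Matrix (Fin m) (Fin m) ℝ := fun t => Matrix.of fun i j => f₁ j t i
  let C₂ : ℝ → Matrix (Fin m) (Fin m) ℝ := fun t => Matrix.of fun i j => f₂ j t i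
  have hC : ∀ᶠ t in 𝓝 t₀, ∀ i j, HasDerivAt (fun s => C s i j) (C₁ t i j) t := by
    filter_upwards [hf] with t ht i j
    exact hasDerivAt_pi.1 (ht j).1 i
  have hC₁ : ∀ᶠ t in 𝓝 t₀, ∀ i j, HasDerivAt (fun s => C₁ s i j) (C₂ t i j) t := by
    filter_upwards [hf] with t ht i j
    exact hasDerivAt_pi.1 (ht j).2.1 i
  have hw : ∀ᶠ t in 𝓝 t₀, ∀ a, comb (ŵ t) a = comb (w t) (C t *ᵥ a) := by
    filter_upwards [hf] with t ht a
    rw [← comb_comb]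
    congr 2
    funext j
    exact (ht j).2.2.1
  have hu : ∀ᶠ t in 𝓝 t₀, ∀ a,
      comb (û t) a = comb (w t) (C₁ t *ᵥ a) + comb (u t) (C t *ᵥ a) := by
    filter_upwards [hf] with t ht a
    rw [← comb_comb, ← comb_comb, ← comb_add_left]
    congr 2
    funext j
    exact (ht j).2.2.2.1
  have hH : ∀ᶠ t in 𝓝 t₀, ∀ a, C₂ t *ᵥ a + H₀ t *ᵥ (C t *ᵥ a) =
      C t *ᵥ (Ĥ₀ t *ᵥ a) + C₁ t *ᵥ (Ĥ₁ t *ᵥ a) ∧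
      (2 : ℝ) • (C₁ t *ᵥ a) + H₁ t *ᵥ (C t *ᵥ a) = C t *ᵥ (Ĥ₁ t *ᵥ a) := by
    filter_upwards [hf, hw, hu, hF] with t ht hwt hut hFt a
    have h1 : comb (fun j => comb (ŵ t) ((Ĥ₀ t).col j) + comb (û t) ((Ĥ₁ t).col j)) a =
        comb (w t) (C t *ᵥ (Ĥ₀ t *ᵥ a) + C₁ t *ᵥ (Ĥ₁ t *ᵥ a)) +
          comb (u t) (C t *ᵥ (Ĥ₁ t *ᵥ a)) := by
      rw [comb_add_left, comb_comb, comb_comb, hwt, hut, map_add]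
      abel
    have h2 : comb (fun j => comb (ŵ t) ((Ĥ₀ t).col j) + comb (û t) ((Ĥ₁ t).col j)) a =
        comb (w t) (C₂ t *ᵥ a + H₀ t *ᵥ (C t *ᵥ a)) +
          comb (u t) ((2 : ℝ) • (C₁ t *ᵥ a) + H₁ t *ᵥ (C t *ᵥ a)) := by
      rw [Matrix.mulVec_mulVec, Matrix.mulVec_mulVec, ← Matrix.add_mulVec, ← Matrix.smul_mulVec,
        ← Matrix.add_mulVec, ← comb_comb, ← comb_comb, ← comb_add_left]
      congr 2
      funext j
      rw [(ht j).2.2.2.2]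
      rfl
    exact hFt.unique (h2.symm.trans h1)
  -- This is the derivative of the `u`-coefficient identity 2 C' + H₁ C = C Ĥ₁. Together with the
  -- `w`-coefficient identity it eliminates C'', which leaves K C = C K̂.
  have hd : ∀ a, (2 : ℝ) • (C₂ t₀ *ᵥ a) + (H₁' t₀ *ᵥ (C t₀ *ᵥ a) + H₁ t₀ *ᵥ (C₁ t₀ *ᵥ a)) =
      C₁ t₀ *ᵥ (Ĥ₁ t₀ *ᵥ a) + C t₀ *ᵥ (Ĥ₁' t₀ *ᵥ a) := by
    intro a
    have hc : ∀ {N : ℝ → Matrix (Fin m) (Fin m) ℝ} {N' : Matrix (Fin m) (Fin m) ℝ},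
        (∀ i j, HasDerivAt (fun s => N s i j) (N' i j) t₀) →
        HasDerivAt (fun s => N s *ᵥ a) (N' *ᵥ a) t₀ := by
      intro N N' hN
      simpa using hasDerivAt_mulVec hN (hasDerivAt_const t₀ a)
    have h1 := ((hc hC₁.self_of_nhds).const_smul (2 : ℝ)).add
      (hasDerivAt_mulVec hF.self_of_nhds.deriv_one (hc hC.self_of_nhds))
    have h2 := hasDerivAt_mulVec hC.self_of_nhds (hc hG.self_of_nhds.deriv_one)
    exact h1.unique (h2.congr_of_eventuallyEq (hH.mono fun t ht => (ht a).2))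
  have ext_mulVec : ∀ {A B : Matrix (Fin m) (Fin m) ℝ}, (∀ a, A *ᵥ a = B *ᵥ a) → A = B :=
    fun h => Matrix.ext_iff_mulVec.2 h
  have e1 : C₂ t₀ + H₀ t₀ * C t₀ = C t₀ * Ĥ₀ t₀ + C₁ t₀ * Ĥ₁ t₀ := by
    refine ext_mulVec fun a => ?_
    simpa [Matrix.add_mulVec] using (hH.self_of_nhds a).1
  have e2 : (2 : ℝ) • C₁ t₀ + H₁ t₀ * C t₀ = C t₀ * Ĥ₁ t₀ := by
    refine ext_mulVec fun a => ?_
    simpa [Matrix.add_mulVec, Matrix.smul_mulVec] using (hH.self_of_nhds a).2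
  have e3 : (2 : ℝ) • C₂ t₀ + (H₁' t₀ * C t₀ + H₁ t₀ * C₁ t₀) =
      C₁ t₀ * Ĥ₁ t₀ + C t₀ * Ĥ₁' t₀ := by
    refine ext_mulVec fun a => ?_
    simpa [Matrix.add_mulVec, Matrix.smul_mulVec] using hd a
  refine ⟨C t₀, C₁ t₀, hw.self_of_nhds, hu.self_of_nhds, e2, ?_⟩
  have e4 : C t₀ * (Ĥ₁ t₀ * Ĥ₁ t₀) =
      (2 : ℝ) • (C₁ t₀ * Ĥ₁ t₀) + ((2 : ℝ) • (H₁ t₀ * C₁ t₀) + H₁ t₀ * (H₁ t₀ * C t₀)) := by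
    rw [← mul_assoc, ← e2, add_mul, mul_assoc (H₁ t₀), ← e2, mul_add, smul_mul_assoc,
      mul_smul_comm]
  have e1' : C t₀ * Ĥ₀ t₀ = C₂ t₀ + H₀ t₀ * C t₀ - C₁ t₀ * Ĥ₁ t₀ := eq_sub_of_add_eq e1.symm
  have e3' : C t₀ * Ĥ₁' t₀ = (2 : ℝ) • C₂ t₀ + (H₁' t₀ * C t₀ + H₁ t₀ * C₁ t₀) -
      C₁ t₀ * Ĥ₁ t₀ := eq_sub_of_add_eq' e3.symm
  simp only [movingCurvature, add_mul, sub_mul, neg_mul, mul_add, mul_sub, mul_neg, smul_mul_assoc,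
    mul_smul_comm, mul_assoc, e4, e1', e3']
  module

end ChangeOfFrame

/-! ### The Jacobi equation of a fixed vector -/

section Jacobi

variable {m : ℕ} {E : Type*} [NormedAddCommGroup E] [NormedSpace ℝ E] [FiniteDimensional ℝ E]
  {L : ℝ → Submodule ℝ E} {w u : ℝ → Fin m → E}
  {H₀ H₁ H₁' : ℝ → Matrix (Fin m) (Fin m) ℝ} {t₀ : ℝ} {v : E}

/-- With respect to the moving frame `(w, u)` at time `t`, the fixed vector `v` has vertical
representative `B` and `-P` is its projection to the moving subspace along the horizontal one. -/
def IsJacobiPairIn (w u : ℝ → Fin m → E) (H₁ : ℝ → Matrix (Fin m) (Fin m) ℝ) (v : E) (t : ℝ)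
    (B P : E) : Prop :=
  ∃ a b : Fin m → ℝ, v = comb (w t) a + comb (u t) b ∧ B = comb (w t) b ∧
    P = comb (w t) (-(a + (1 / 2 : ℝ) • (H₁ t *ᵥ b)))

/-- The pair `(B, P)` does not depend on the moving frame. -/
theorem IsJacobiPairIn.change {ŵ û : ℝ → Fin m → E}
    {Ĥ₀ Ĥ₁ Ĥ₁' : ℝ → Matrix (Fin m) (Fin m) ℝ} {B P : E}
    (h : IsJacobiPairIn ŵ û Ĥ₁ v t₀ B P)
    (hF : ∀ᶠ t in 𝓝 t₀, IsMovingFrameAt L w u H₀ H₁ H₁' t)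
    (hG : ∀ᶠ t in 𝓝 t₀, IsMovingFrameAt L ŵ û Ĥ₀ Ĥ₁ Ĥ₁' t) :
    IsJacobiPairIn w u H₁ v t₀ B P := by
  obtain ⟨a, b, hv, hB, hP⟩ := h
  obtain ⟨C, C₁, hw, hu, hC, -⟩ := exists_change_of_frame hF hG
  refine ⟨C *ᵥ a + C₁ *ᵥ b, C *ᵥ b, ?_, by rw [hB, hw], ?_⟩
  · rw [hv, hw, hu, map_add]; abel
  · rw [hP, hw]
    congr 1
    -- The transformation rule of the connection matrix ½ H₁; it absorbs the term C₁ b in the new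
    -- coefficient of v.
    have : H₁ t₀ *ᵥ (C *ᵥ b) = C *ᵥ (Ĥ₁ t₀ *ᵥ b) - (2 : ℝ) • (C₁ *ᵥ b) := by
      rw [Matrix.mulVec_mulVec, Matrix.mulVec_mulVec, ← hC, Matrix.add_mulVec, Matrix.smul_mulVec]
      abel
    rw [this, Matrix.mulVec_neg, Matrix.mulVec_add, Matrix.mulVec_smul]
    module

/-- The span of a moving frame and its derivative is locally constant. -/
theorem locally_mem_span (hF : ∀ᶠ t in 𝓝 t₀, IsMovingFrameAt L w u H₀ H₁ H₁' t) (v : E) :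
    ∃ N ∈ 𝓝 t₀, ∀ t₁ ∈ N, ∀ t ∈ N, (∃ a b, v = comb (w t₁) a + comb (u t₁) b) →
      ∃ a b, v = comb (w t) a + comb (u t) b := by
  -- The system satisfied by the values (ℓ(w), ℓ(u)) of a fixed linear functional ℓ; hence the
  -- transposed matrices.
  let A : ℝ → (Fin m → ℝ) × (Fin m → ℝ) →L[ℝ] (Fin m → ℝ) × (Fin m → ℝ) :=
    fun t => LinearMap.toContinuousLinearMap
    { toFun := fun x => (x.2, fun j => ∑ i, H₀ t i j * x.1 i + ∑ i, H₁ t i j * x.2 i)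
      map_add' := by
        intro x y
        ext j
        · simp
        · simp [mul_add, Finset.sum_add_distrib]; abel
      map_smul' := by
        intro r x
        ext j
        · simp
        · simp only [Prod.smul_fst, Prod.smul_snd, Pi.smul_apply, smul_eq_mul, RingHom.id_apply,
            mul_add, Finset.mul_sum, mul_left_comm] }
  have hAapp : ∀ t x, A t x =
      (x.2, fun j => ∑ i, H₀ t i j * x.1 i + ∑ i, H₁ t i j * x.2 i) := fun t x => rfl
  have hA : ContinuousAt A t₀ := by
    rw [continuousAt_clm_apply]
    intro x
    simp only [hAapp]
    refine continuousAt_const.prodMk ?_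
    rw [continuousAt_pi]
    intro j
    refine ContinuousAt.add ?_ ?_
    · exact tendsto_finsetSum _ fun i _ =>
        (hF.self_of_nhds.continuousAt_zero i j).mul continuousAt_const
    · exact tendsto_finsetSum _ fun i _ =>
        (hF.self_of_nhds.deriv_one i j).continuousAt.mul continuousAt_const
  obtain ⟨N, hN, hNS, hode⟩ := eventually_eq_zero_of_linear_ode hA hF
  refine ⟨N, hN, ?_⟩
  rintro t₁ ht₁ t ht ⟨a, b, hv⟩
  by_contra hcon
  have hv' : v ∉ LinearMap.range (comb (w t)) ⊔ LinearMap.range (comb (u t)) := by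
    intro h
    obtain ⟨_, ⟨a, rfl⟩, _, ⟨b, rfl⟩, h⟩ := Submodule.mem_sup.1 h
    exact hcon ⟨a, b, h.symm⟩
  -- ℓ kills the span at time t but not v. By uniqueness for the linear system it kills the span at
  -- time t₁ too, and v lies there.
  obtain ⟨ℓ, hℓv, hℓ⟩ := Submodule.exists_le_ker_of_notMem hv'
  let ℓ' : E →L[ℝ] ℝ := LinearMap.toContinuousLinearMap ℓ
  let Y : ℝ → (Fin m → ℝ) × (Fin m → ℝ) := fun s => (fun i => ℓ' (w s i), fun i => ℓ' (u s i))
  have hY : ∀ s, IsMovingFrameAt L w u H₀ H₁ H₁' s → HasDerivAt Y (A s (Y s)) s := by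
    intro s hs
    rw [hAapp]
    refine HasDerivAt.prodMk ?_ ?_
    · exact hasDerivAt_pi.2 fun i =>
        ℓ'.hasFDerivAt.comp_hasDerivAt s (hasDerivAt_pi.1 hs.deriv_fst i)
    · refine hasDerivAt_pi.2 fun i => ?_
      refine (ℓ'.hasFDerivAt.comp_hasDerivAt s (hasDerivAt_pi.1 hs.deriv_snd i)).congr_deriv ?_
      simp [comb_apply, Y]
  have hYt : Y t = 0 := by
    classical
    have h1 : ∀ i, ℓ' (w t i) = 0 := fun i => hℓ (Submodule.mem_sup_left
      ⟨Pi.single i 1, comb_single _ _⟩)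
    have h2 : ∀ i, ℓ' (u t i) = 0 := fun i => hℓ (Submodule.mem_sup_right
      ⟨Pi.single i 1, comb_single _ _⟩)
    simp only [Y, h1, h2]
    rfl
  have hYt₁ := hode Y (fun s hs => hY s hs) t ht hYt t₁ ht₁
  have h1 : ∀ i, ℓ (w t₁ i) = 0 := fun i => congrFun (congrArg Prod.fst hYt₁) i
  have h2 : ∀ i, ℓ (u t₁ i) = 0 := fun i => congrFun (congrArg Prod.snd hYt₁) i
  apply hℓv
  rw [hv, map_add, map_comb, map_comb]
  simp [comb_apply, h1, h2]

/-- The evolution of the Jacobi pair of a fixed vector in a moving frame. -/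
theorem exists_jacobi_evolution (hF : ∀ᶠ t in 𝓝 t₀, IsMovingFrameAt L w u H₀ H₁ H₁' t)
    (hv : ∃ a b, v = comb (w t₀) a + comb (u t₀) b) :
    ∃ (b p : ℝ → Fin m → ℝ), HasDerivAt b (p t₀ - (1 / 2 : ℝ) • (H₁ t₀ *ᵥ b t₀)) t₀ ∧
      HasDerivAt p (-(movingCurvature H₀ H₁ H₁' t₀ *ᵥ b t₀) -
        (1 / 2 : ℝ) • (H₁ t₀ *ᵥ p t₀)) t₀ ∧
      ∀ᶠ t in 𝓝 t₀, ∀ B P, IsJacobiPairIn w u H₁ v t B P →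
        B = comb (w t) (b t) ∧ P = comb (w t) (p t) := by
  obtain ⟨N, hN, hmem⟩ := locally_mem_span hF v
  obtain ⟨a, b, hab⟩ := exists_differentiable_coefficients hF (z := fun _ => v)
    (Eventually.of_forall fun t => differentiableAt_const v)
    (by filter_upwards [hN] with t ht using hmem t₀ (mem_of_mem_nhds hN) t ht hv)
  obtain ⟨hv₀, hda, hdb⟩ := hab.self_of_nhds
  -- Since v is constant, both coefficients of its derivative vanish: a' = -H₀ b and b' = -a - H₁ b.
  have h0 : comb (w t₀) (deriv a t₀ + H₀ t₀ *ᵥ b t₀) +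
      comb (u t₀) (deriv b t₀ + a t₀ + H₁ t₀ *ᵥ b t₀) = 0 :=
    ((hF.self_of_nhds.hasDerivAt_comb_add hda.hasDerivAt hdb.hasDerivAt).congr_of_eventuallyEq
      (hab.mono fun t ht => ht.1)).unique (hasDerivAt_const t₀ v)
  obtain ⟨ha', hb'⟩ := hF.self_of_nhds.eq_zero _ _ h0
  have ha' : deriv a t₀ = -(H₀ t₀ *ᵥ b t₀) := eq_neg_of_add_eq_zero_left ha'
  have hb' : deriv b t₀ = -a t₀ - H₁ t₀ *ᵥ b t₀ := by
    rw [add_assoc] at hb'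
    rw [eq_neg_of_add_eq_zero_left hb']; abel
  have hb : HasDerivAt b (-a t₀ - H₁ t₀ *ᵥ b t₀) t₀ := hb' ▸ hdb.hasDerivAt
  refine ⟨b, fun t => -(a t + (1 / 2 : ℝ) • (H₁ t *ᵥ b t)), ?_, ?_, ?_⟩
  · refine hb.congr_deriv ?_
    module
  · refine ((ha' ▸ hda.hasDerivAt).add ((hasDerivAt_mulVec hF.self_of_nhds.deriv_one
      hb).const_smul (1 / 2 : ℝ))).neg.congr_deriv ?_
    simp only [movingCurvature, Matrix.add_mulVec, Matrix.sub_mulVec, Matrix.neg_mulVec,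
      Matrix.smul_mulVec, Matrix.mulVec_add, Matrix.mulVec_sub, Matrix.mulVec_neg,
      Matrix.mulVec_smul, Matrix.mulVec_mulVec]
    module
  · filter_upwards [hF, hab] with t ht habt
    rintro B P ⟨a', b', hv', rfl, rfl⟩
    obtain ⟨rfl, rfl⟩ := ht.unique (hv'.symm.trans habt.1)
    exact ⟨rfl, rfl⟩

end Jacobi

/-! ### Invariant metrics and the comparison argument in a fixed vector space -/

section Metric

variable {m : ℕ} {E : Type*} [NormedAddCommGroup E] [NormedSpace ℝ E]

theorem bilin_comb {ι κ F : Type*} [Fintype ι] [Fintype κ] [AddCommGroup F] [Module ℝ F]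
    (G : LinearMap.BilinForm ℝ F) (x : ι → F) (y : κ → F) (a : ι → ℝ) (b : κ → ℝ) :
    G (comb x a) (comb y b) = ∑ i, ∑ j, a i * b j * G (x i) (y j) := by
  simp only [comb_apply, map_sum, LinearMap.sum_apply, map_smul, LinearMap.smul_apply,
    smul_eq_mul, Finset.mul_sum]
  refine (Finset.sum_comm).trans ?_
  refine Finset.sum_congr rfl fun i _ => Finset.sum_congr rfl fun j _ => ?_
  ring

/-- Derivative of a metric which is invariant with respect to the connection matrix `N`. -/
theorem hasDerivWithinAt_metric {G : ℝ → LinearMap.BilinForm ℝ E} {w : ℝ → Fin m → E}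
    {N : Matrix (Fin m) (Fin m) ℝ} {S : Set ℝ} {t₀ : ℝ}
    (hG : ∀ i j, HasDerivWithinAt (fun s => G s (w s i) (w s j))
      (G t₀ (comb (w t₀) (N.col i)) (w t₀ j) + G t₀ (w t₀ i) (comb (w t₀) (N.col j))) S t₀)
    {b p : ℝ → Fin m → ℝ} {b' p' : Fin m → ℝ}
    (hb : HasDerivAt b b' t₀) (hp : HasDerivAt p p' t₀) :
    HasDerivWithinAt (fun s => G s (comb (w s) (b s)) (comb (w s) (p s)))
      (G t₀ (comb (w t₀) (b' + N *ᵥ b t₀)) (comb (w t₀) (p t₀)) +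
        G t₀ (comb (w t₀) (b t₀)) (comb (w t₀) (p' + N *ᵥ p t₀))) S t₀ := by
  have h1 : HasDerivWithinAt (fun s => G s (comb (w s) (b s)) (comb (w s) (p s)))
      (∑ i, ∑ j, ((b' i * p t₀ j + b t₀ i * p' j) * G t₀ (w t₀ i) (w t₀ j) +
        b t₀ i * p t₀ j * (G t₀ (comb (w t₀) (N.col i)) (w t₀ j) +
          G t₀ (w t₀ i) (comb (w t₀) (N.col j))))) S t₀ := by
    simp only [bilin_comb]
    refine HasDerivWithinAt.fun_sum fun i _ => HasDerivWithinAt.fun_sum fun j _ => ?_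
    exact ((hasDerivAt_pi.1 hb i).mul (hasDerivAt_pi.1 hp j)).hasDerivWithinAt.mul (hG i j)
  refine h1.congr_deriv ?_
  simp only [map_add, LinearMap.add_apply, ← comb_comb]
  simp only [bilin_comb, ← Finset.sum_add_distrib]
  refine Finset.sum_congr rfl fun i _ => Finset.sum_congr rfl fun j _ => ?_
  ring

variable [FiniteDimensional ℝ E]

/-- A fixed vector which lies in the moving subspace at both ends of the time interval vanishes,
if there is an invariant metric for which the curvature is at most `lam` and the interval is
shorter than `π / √lam`. -/
theorem eq_zero_of_mem_endpoints {L : ℝ → Submodule ℝ E} {G : ℝ → LinearMap.BilinForm ℝ E}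
    {τ lam : ℝ} (hτ : 0 < τ) (hlam : 0 ≤ lam) (hlt : √lam * τ < Real.pi)
    (hsymm : ∀ t ∈ Icc 0 τ, ∀ x ∈ L t, ∀ y ∈ L t, G t x y = G t y x)
    (hpos : ∀ t ∈ Icc 0 τ, ∀ x ∈ L t, x ≠ 0 → 0 < G t x x)
    (hframe : ∀ t₀ ∈ Icc 0 τ, ∃ (w u : ℝ → Fin m → E) (H₀ H₁ H₁' : ℝ → Matrix (Fin m) (Fin m) ℝ),
      (∀ᶠ t in 𝓝 t₀, IsMovingFrameAt L w u H₀ H₁ H₁' t) ∧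
      (∀ i j, HasDerivWithinAt (fun s => G s (w s i) (w s j))
        (G t₀ (comb (w t₀) (((1 / 2 : ℝ) • H₁ t₀).col i)) (w t₀ j) +
          G t₀ (w t₀ i) (comb (w t₀) (((1 / 2 : ℝ) • H₁ t₀).col j))) (Icc 0 τ) t₀) ∧
      ∀ b, G t₀ (comb (w t₀) (movingCurvature H₀ H₁ H₁' t₀ *ᵥ b)) (comb (w t₀) b) ≤
        lam * G t₀ (comb (w t₀) b) (comb (w t₀) b))
    {v : E} (hv0 : v ∈ L 0) (hvτ : v ∈ L τ) : v = 0 := by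
  have h0 : (0 : ℝ) ∈ Icc 0 τ := ⟨le_rfl, hτ.le⟩
  have hτ' : τ ∈ Icc 0 τ := ⟨hτ.le, le_rfl⟩
  choose! w u H₀ H₁ H₁' hF hGd hK using hframe
  -- `v` stays in the derived moving subspace
  have hspan : ∀ t ∈ Icc 0 τ, ∃ a b, v = comb (w t t) a + comb (u t t) b := by
    intro t ht
    refine propagate (τ := τ) (Q := fun t => ∃ a b, v = comb (w t t) a + comb (u t t) b)
      ?_ h0 ht ?_
    · intro t₀ ht₀
      obtain ⟨N, hN, hmem⟩ := locally_mem_span (hF t₀ ht₀) v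
      refine ⟨N ∩ {t | ∀ᶠ s in 𝓝 t, IsMovingFrameAt L (w t₀) (u t₀) (H₀ t₀) (H₁ t₀) (H₁' t₀) s},
        inter_mem hN (hF t₀ ht₀).eventually_nhds, ?_⟩
      rintro t₁ ⟨ht₁, hF₁⟩ t ⟨ht, hFt⟩ hI₁ hI ⟨a, b, hab⟩
      have h1 : IsJacobiPairIn (w t₁) (u t₁) (H₁ t₁) v t₁ _ _ := ⟨a, b, hab, rfl, rfl⟩
      obtain ⟨a', b', hab', -⟩ := h1.change hF₁ (hF t₁ hI₁)
      obtain ⟨a₂, b₂, hab₂⟩ := hmem t₁ ht₁ t ht ⟨a', b', hab'⟩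
      have h2 : IsJacobiPairIn (w t₀) (u t₀) (H₁ t₀) v t _ _ := ⟨a₂, b₂, hab₂, rfl, rfl⟩
      obtain ⟨a₃, b₃, hab₃, -⟩ := h2.change (hF t hI) hFt
      exact ⟨a₃, b₃, hab₃⟩
    · rw [← (hF 0 h0).self_of_nhds.range_eq] at hv0
      obtain ⟨a, ha⟩ := hv0
      exact ⟨a, 0, by simp [ha]⟩
  have hpair : ∀ t ∈ Icc 0 τ, ∃ B P, IsJacobiPairIn (w t) (u t) (H₁ t) v t B P := by
    intro t ht
    obtain ⟨a, b, hab⟩ := hspan t ht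
    exact ⟨_, _, a, b, hab, rfl, rfl⟩
  choose! B P hBP using hpair
  have hBL : ∀ t ∈ Icc 0 τ, B t ∈ L t := by
    intro t ht
    obtain ⟨a, b, -, hB, -⟩ := hBP t ht
    rw [hB, ← (hF t ht).self_of_nhds.range_eq]; exact ⟨b, rfl⟩
  have hPL : ∀ t ∈ Icc 0 τ, P t ∈ L t := by
    intro t ht
    obtain ⟨a, b, -, -, hP⟩ := hBP t ht
    rw [hP, ← (hF t ht).self_of_nhds.range_eq]; exact ⟨_, rfl⟩
  have hB_zero : ∀ t ∈ Icc 0 τ, v ∈ L t → B t = 0 := by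
    intro t ht hvt
    obtain ⟨a, b, hv, hB, -⟩ := hBP t ht
    rw [← (hF t ht).self_of_nhds.range_eq] at hvt
    obtain ⟨a', ha'⟩ := hvt
    have := ((hF t ht).self_of_nhds.unique (a := a') (b := 0)
      ((by rw [map_zero, add_zero] : _ = comb (w t t) a').trans (ha'.trans hv))).2
    rw [hB, ← this, map_zero]
  have hnonneg : ∀ t ∈ Icc 0 τ, ∀ x ∈ L t, 0 ≤ G t x x := by
    intro t ht x hx
    by_cases h : x = 0
    · simp [h]
    · exact (hpos t ht x hx h).le
  -- derivatives of the scalar quantities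
  have hderiv : ∀ t ∈ Icc 0 τ,
      HasDerivWithinAt (fun s => G s (B s) (B s)) (2 * G t (P t) (B t)) (Icc 0 τ) t ∧
      ∃ h', HasDerivWithinAt (fun s => G s (P s) (B s)) h' (Icc 0 τ) t ∧
        G t (P t) (P t) - lam * G t (B t) (B t) ≤ h' := by
    intro t ht
    obtain ⟨b, p, hb, hp, hloc⟩ := exists_jacobi_evolution (hF t ht) (hspan t ht)
    -- `B s` and `P s` were defined with the frame chosen at time s. Near t they are rewritten in
    -- the single frame chosen at time t, where they can be differentiated.
    have hloc' : ∀ᶠ s in 𝓝[Icc 0 τ] t, B s = comb (w t s) (b s) ∧ P s = comb (w t s) (p s) := by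
      filter_upwards [mem_nhdsWithin_of_mem_nhds hloc, self_mem_nhdsWithin,
        mem_nhdsWithin_of_mem_nhds (hF t ht).eventually_nhds] with s hs hsI hFs
      exact hs _ _ ((hBP s hsI).change hFs (hF s hsI))
    obtain ⟨hBt, hPt⟩ := hloc.self_of_nhds _ _ (hBP t ht)
    -- Adding the connection term ½ H₁ turns the ordinary derivatives into D B = P and, next, D P =
    -- -K B.
    have hb' : p t - (1 / 2 : ℝ) • (H₁ t t *ᵥ b t) + ((1 / 2 : ℝ) • H₁ t t) *ᵥ b t = p t := by
      rw [Matrix.smul_mulVec]; abel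
    have hp' : -(movingCurvature (H₀ t) (H₁ t) (H₁' t) t *ᵥ b t) -
        (1 / 2 : ℝ) • (H₁ t t *ᵥ p t) + ((1 / 2 : ℝ) • H₁ t t) *ᵥ p t =
        -(movingCurvature (H₀ t) (H₁ t) (H₁' t) t *ᵥ b t) := by
      rw [Matrix.smul_mulVec]; abel
    refine ⟨?_, ?_⟩
    · have h1 := hasDerivWithinAt_metric (hGd t ht) hb hb
      rw [hb', ← hBt, ← hPt, hsymm t ht _ (hBL t ht) _ (hPL t ht), ← two_mul] at h1
      refine h1.congr_of_eventuallyEq ?_ (by rw [hBt])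
      filter_upwards [hloc'] with s hs
      rw [hs.1]
    · have h1 := hasDerivWithinAt_metric (hGd t ht) hp hb
      rw [hb', hp', ← hBt, ← hPt] at h1
      refine ⟨_, h1.congr_of_eventuallyEq ?_ (by rw [hBt, hPt]), ?_⟩
      · filter_upwards [hloc'] with s hs
        rw [hs.1, hs.2]
      · have h2 := hK t ht (b t)
        rw [← hBt] at h2
        rw [map_neg, map_neg, LinearMap.neg_apply]
        linarith
  have hex : ∀ t ∈ Icc 0 τ, ∃ h', HasDerivWithinAt (fun s => G s (P s) (B s)) h' (Icc 0 τ) t ∧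
      G t (P t) (P t) - lam * G t (B t) (B t) ≤ h' := fun t ht => (hderiv t ht).2
  choose! h' hh' hh'' using hex
  have hzero : ∀ t ∈ Icc 0 τ, G t (B t) (B t) = 0 := by
    refine eqOn_zero_of_comparison (e := fun t => G t (P t) (P t)) hlam hlt
      (fun t ht => (hderiv t ht).1) hh' hh'' ?_ ?_ ?_ ?_ fun t ht => hnonneg t ht _ (hBL t ht)
    · intro t ht r
      have h1 := hnonneg t ht (P t - r • B t)
        ((L t).sub_mem (hPL t ht) ((L t).smul_mem r (hBL t ht)))
      simp only [map_sub, map_smul, LinearMap.sub_apply, LinearMap.smul_apply, smul_eq_mul,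
        hsymm t ht _ (hBL t ht) _ (hPL t ht)] at h1
      linarith
    · simp [hB_zero 0 h0 hv0]
    · simp [hB_zero 0 h0 hv0]
    · simp [hB_zero τ hτ' hvτ]
  have hB : ∀ t ∈ Icc 0 τ, B t = 0 := by
    intro t ht
    by_contra hne
    exact (hpos t ht _ (hBL t ht) hne).ne' (hzero t ht)
  -- hence the derivative `P` of `B` vanishes at time `0` as well
  have hd0 : h' 0 = 0 := by
    have h1 : HasDerivWithinAt (fun s => G s (P s) (B s)) 0 (Icc 0 τ) 0 := by
      refine (hasDerivWithinAt_const (0 : ℝ) (Icc 0 τ) (0 : ℝ)).congr ?_ (by simp [hB 0 h0])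
      intro s hs
      simp [hB s hs]
    exact (uniqueDiffOn_Icc hτ 0 h0).eq_deriv _ (hh' 0 h0) h1
  -- As B vanishes identically, ⟨P,B⟩ has derivative 0, and |P|² - lam |B|² ≤ h' leaves |P(0)|² ≤ 0.
  have hP0 : P 0 = 0 := by
    by_contra hne
    have h1 := hpos 0 h0 _ (hPL 0 h0) hne
    have h2 := hh'' 0 h0
    rw [hd0, hB 0 h0] at h2
    simp only [map_zero] at h2
    linarith
  obtain ⟨a, b, hv, hB0, hPa⟩ := hBP 0 h0
  rw [hB 0 h0] at hB0
  have hb0 : b = 0 := ((hF 0 h0).self_of_nhds.eq_zero b 0 (by rw [map_zero, add_zero, ← hB0])).1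
  subst hb0
  rw [hP0, Matrix.mulVec_zero, smul_zero, add_zero, map_neg, eq_comm, neg_eq_zero] at hPa
  rw [hv, hPa, map_zero, add_zero]

end Metric

/-! ### The linearised flow and vector fields in charts -/

/-- The variational equation: the spatial derivative of a solution operator satisfies the linearized
differential equation. -/
theorem hasDerivAt_variational {E F : Type*} [NormedAddCommGroup E] [NormedSpace ℝ E]
    [NormedAddCommGroup F] [NormedSpace ℝ F]
    {f : ℝ × E → F} {X : F → F} {t₀ : ℝ} {z₀ : E} (hf : ContDiffAt ℝ 2 f (t₀, z₀))
    (hX : DifferentiableAt ℝ X (f (t₀, z₀)))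
    (hode : ∀ᶠ p in 𝓝 (t₀, z₀), fderiv ℝ f p (1, 0) = X (f p)) :
    HasDerivAt (fun s => (fderiv ℝ f (s, z₀)).comp (ContinuousLinearMap.inr ℝ ℝ E))
      ((fderiv ℝ X (f (t₀, z₀))).comp
        ((fderiv ℝ f (t₀, z₀)).comp (ContinuousLinearMap.inr ℝ ℝ E))) t₀ := by
  have h1 : DifferentiableAt ℝ (fderiv ℝ f) (t₀, z₀) :=
    (hf.fderiv_right (m := 1) (by norm_num)).differentiableAt (by norm_num)
  have h2 : HasDerivAt (fun s : ℝ => (s, z₀)) ((1 : ℝ), (0 : E)) t₀ :=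
    (hasDerivAt_id t₀).prodMk (hasDerivAt_const t₀ z₀)
  have h3 : HasDerivAt (fun s => fderiv ℝ f (s, z₀))
      (fderiv ℝ (fderiv ℝ f) (t₀, z₀) (1, 0)) t₀ :=
    h1.hasFDerivAt.comp_hasDerivAt t₀ h2
  have h4 : HasDerivAt (fun s => (fderiv ℝ f (s, z₀)).comp (ContinuousLinearMap.inr ℝ ℝ E))
      ((fderiv ℝ (fderiv ℝ f) (t₀, z₀) (1, 0)).comp (ContinuousLinearMap.inr ℝ ℝ E)) t₀ := by
    simpa using h3.clm_comp (hasDerivAt_const t₀ (ContinuousLinearMap.inr ℝ ℝ E))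
  refine h4.congr_deriv ?_
  ext v
  -- Symmetry of the second derivative exchanges time and space derivatives; what remains is the
  -- equation ∂ₜf = X ∘ f differentiated in space.
  have hsymm := hf.isSymmSndFDerivAt (by simp) (1, 0) ((0 : ℝ), v)
  simp only [ContinuousLinearMap.comp_apply, ContinuousLinearMap.inr_apply]
  rw [hsymm]
  have h5 : HasFDerivAt (fun p => fderiv ℝ f p (1, 0))
      ((fderiv ℝ (fderiv ℝ f) (t₀, z₀)).flip (1, 0)) (t₀, z₀) := by
    simpa using h1.hasFDerivAt.clm_apply (hasFDerivAt_const ((1 : ℝ), (0 : E)) (t₀, z₀))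
  have h6 : HasFDerivAt (fun p => X (f p))
      ((fderiv ℝ X (f (t₀, z₀))).comp (fderiv ℝ f (t₀, z₀))) (t₀, z₀) :=
    hX.hasFDerivAt.comp (t₀, z₀) (hf.differentiableAt (by norm_num)).hasFDerivAt
  have h7 := (h6.congr_of_eventuallyEq hode).unique h5
  exact (DFunLike.congr_fun h7 ((0 : ℝ), v)).symm

section Chart

variable {E : Type*} [NormedAddCommGroup E] [NormedSpace ℝ E]
  {M : Type*} [TopologicalSpace M] [ChartedSpace E M] [IsManifold 𝓘(ℝ, E) ∞ M]

/-- `Y` is a smooth vector field near `x`. -/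
abbrev SmoothAt (Y : VField E M) (x : M) : Prop :=
  ContMDiffAt 𝓘(ℝ, E) 𝓘(ℝ, E).tangent ∞ (fun y => (⟨y, Y y⟩ : TangentBundle 𝓘(ℝ, E) M)) x

/-- The differential at `y` of the chart centred at `x`. -/
noncomputable def chartDeriv (x y : M) : E →L[ℝ] E :=
  mfderiv 𝓘(ℝ, E) 𝓘(ℝ, E) (extChartAt 𝓘(ℝ, E) x) y

/-- The expression of the vector field `Y` in the chart centred at `x`. -/
noncomputable def chartField (x : M) (Y : VField E M) : E → E :=
  VectorField.mpullbackWithin 𝓘(ℝ, E) 𝓘(ℝ, E) (extChartAt 𝓘(ℝ, E) x).symm Y (range 𝓘(ℝ, E))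

theorem chartDeriv_self (x : M) : chartDeriv (E := E) x x = ContinuousLinearMap.id ℝ E :=
  mfderiv_extChartAt_self

theorem chartDeriv_injective {x y : M} (hy : y ∈ (extChartAt 𝓘(ℝ, E) x).source) :
    Function.Injective (chartDeriv (E := E) x y) :=
  (isInvertible_mfderiv_extChartAt (I := 𝓘(ℝ, E)) hy).injective

/-- The pullback by the inverse chart is the push-forward by the chart, the form needed along a
trajectory. -/
theorem chartField_apply {x y : M} (hy : y ∈ (extChartAt 𝓘(ℝ, E) x).source) (Y : VField E M) :
    chartField x Y (extChartAt 𝓘(ℝ, E) x y) = chartDeriv (E := E) x y (Y y) := by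
  have hinv := isInvertible_mfderivWithin_extChartAt_symm (I := 𝓘(ℝ, E))
    ((extChartAt 𝓘(ℝ, E) x).map_source hy)
  have h := mfderivWithin_extChartAt_symm_comp_mfderiv_extChartAt' (I := 𝓘(ℝ, E)) hy
  refine hinv.inverse_apply_eq.2 ?_
  have h2 := (DFunLike.congr_fun h (Y y)).symm
  have h3 : ∀ z : M, z = y → (Y z : E) = Y y := fun z hz => by rw [hz]
  exact (h3 _ ((extChartAt 𝓘(ℝ, E) x).left_inv hy)).trans h2

theorem contDiffAt_chartField [FiniteDimensional ℝ E] {x : M} {Y : VField E M} (hY : SmoothAt Y x) :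
    ContDiffAt ℝ ∞ (chartField x Y) (extChartAt 𝓘(ℝ, E) x x) := by
  have h := VectorField.contMDiffWithinAt_mpullbackWithin_extChartAt_symm (I := 𝓘(ℝ, E)) (n := ∞)
    (m := ∞) (contMDiffWithinAt_univ.2 hY) uniqueMDiffOn_univ (mem_univ x) (by simp)
  have h2 := contMDiffWithinAt_vectorSpace_iff_contDiffWithinAt.1 h
  refine h2.contDiffAt ?_
  simp only [preimage_univ, inter_univ]
  exact extChartAt_target_mem_nhds x

/-- The subtracted term DX(Y) is the one that the linearised flow equation compensates in
`IsFlowBox.hasDerivAt_pull`. -/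
theorem chartDeriv_bracket (x : M) (X Y : VField E M) :
    chartDeriv (E := E) x x (bracket X Y x) =
      fderiv ℝ (chartField x Y) (extChartAt 𝓘(ℝ, E) x x)
          (chartField x X (extChartAt 𝓘(ℝ, E) x x)) -
        fderiv ℝ (chartField x X) (extChartAt 𝓘(ℝ, E) x x)
          (chartField x Y (extChartAt 𝓘(ℝ, E) x x)) := by
  have h := isInvertible_mfderiv_extChartAt (I := 𝓘(ℝ, E)) (mem_extChartAt_source (I := 𝓘(ℝ, E)) x)
  have h2 := h.self_apply_inverse (VectorField.lieBracketWithin ℝ (E := E)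
    (chartField x X) (chartField x Y)
    ((extChartAt 𝓘(ℝ, E) x).symm ⁻¹' univ ∩ range 𝓘(ℝ, E)) (extChartAt 𝓘(ℝ, E) x x))
  refine Eq.trans h2 ?_
  simp [VectorField.lieBracketWithin]

end Chart

/-! ### The flow in a chart along a trajectory -/

section FlowChart

variable {E : Type*} [NormedAddCommGroup E] [NormedSpace ℝ E] [FiniteDimensional ℝ E]
  {M : Type*} [TopologicalSpace M] [ChartedSpace E M] [IsManifold 𝓘(ℝ, E) ∞ M]

/-- The differential at `x₀` of the flow map at time `t`. -/
noncomputable def flowDeriv (Φ : ℝ → M → M) (x₀ : M) (t : ℝ) : E →L[ℝ] E :=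
  mfderiv 𝓘(ℝ, E) 𝓘(ℝ, E) (Φ t) x₀

/-- The local flow, in the chart centred at a point of the trajectory of `x₀`. -/
theorem exists_flow_chart {X : VField E M} (hX : ∀ x, SmoothAt X x) {Φ : ℝ → M → M} {J : Set ℝ}
    {U : Set M} {x₀ : M} (hJ : IsOpen J) (hU : IsOpen U) (hx₀ : x₀ ∈ U)
    (hΦ : ContMDiffOn (𝓘(ℝ, ℝ).prod 𝓘(ℝ, E)) 𝓘(ℝ, E) ∞ (fun p : ℝ × M => Φ p.1 p.2) (J ×ˢ U))
    (hint : ∀ y ∈ U, IsMIntegralCurveOn (fun s => Φ s y) X J) {t₀ : ℝ} (ht₀ : t₀ ∈ J) :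
    ∃ A : ℝ → E →L[ℝ] E, ContinuousAt A t₀ ∧
      (∀ᶠ s in 𝓝 t₀, Function.Injective (chartDeriv (E := E) (Φ t₀ x₀) (Φ s x₀))) ∧
      (∀ᶠ s in 𝓝 t₀, HasDerivAt
        (fun r => (chartDeriv (Φ t₀ x₀) (Φ r x₀)).comp (flowDeriv Φ x₀ r))
        ((A s).comp ((chartDeriv (Φ t₀ x₀) (Φ s x₀)).comp (flowDeriv Φ x₀ s))) s) ∧
      ∀ Y : VField E M, SmoothAt Y (Φ t₀ x₀) →
        HasDerivAt (fun s => chartDeriv (E := E) (Φ t₀ x₀) (Φ s x₀) (Y (Φ s x₀)))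
          (chartDeriv (E := E) (Φ t₀ x₀) (Φ t₀ x₀) (bracket X Y (Φ t₀ x₀)) +
            A t₀ (chartDeriv (E := E) (Φ t₀ x₀) (Φ t₀ x₀) (Y (Φ t₀ x₀)))) t₀ := by
  set x₁ := Φ t₀ x₀ with hx₁
  let ψ := extChartAt 𝓘(ℝ, E) x₁
  let φ := extChartAt 𝓘(ℝ, E) x₀
  let z₀ : E := φ x₀
  let f : ℝ × E → E := fun p => ψ (Φ p.1 (φ.symm p.2))
  have hz₀ : φ.symm z₀ = x₀ := extChartAt_to_inv x₀
  have hfz : ∀ s, f (s, z₀) = ψ (Φ s x₀) := by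
    intro s
    simp only [f, hz₀]
  have hΦat : ∀ s ∈ J, ∀ y ∈ U,
      ContMDiffAt (𝓘(ℝ, ℝ).prod 𝓘(ℝ, E)) 𝓘(ℝ, E) ∞ (fun p : ℝ × M => Φ p.1 p.2) (s, y) :=
    fun s hs y hy => hΦ.contMDiffAt ((hJ.prod hU).mem_nhds ⟨hs, hy⟩)
  have hsymm : ∀ z ∈ φ.target, ContMDiffAt 𝓘(ℝ, E) 𝓘(ℝ, E) ∞ φ.symm z := fun z hz =>
    (contMDiffOn_extChartAt_symm x₀).contMDiffAt
      ((isOpen_extChartAt_target x₀).mem_nhds hz)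
  have hpair : ∀ p : ℝ × E, p.2 ∈ φ.target →
      ContMDiffAt 𝓘(ℝ, ℝ × E) (𝓘(ℝ, ℝ).prod 𝓘(ℝ, E)) ∞
        (fun p : ℝ × E => (p.1, φ.symm p.2)) p := by
    intro p hp
    refine ContMDiffAt.prodMk contDiff_fst.contMDiff.contMDiffAt ?_
    exact (hsymm p.2 hp).comp p contDiff_snd.contMDiff.contMDiffAt
  have hgood : ∀ᶠ p : ℝ × E in 𝓝 (t₀, z₀), p.1 ∈ J ∧ p.2 ∈ φ.target ∧ φ.symm p.2 ∈ U ∧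
      Φ p.1 (φ.symm p.2) ∈ ψ.source := by
    have hz : z₀ ∈ φ.target := mem_extChartAt_target x₀
    have c1 : ContinuousAt (fun p : ℝ × E => φ.symm p.2) (t₀, z₀) :=
      ((hsymm z₀ hz).continuousAt).comp (f := fun p : ℝ × E => p.2) continuousAt_snd
    have c2 : ContinuousAt (fun p : ℝ × E => Φ p.1 (φ.symm p.2)) (t₀, z₀) := by
      have := (hΦat t₀ ht₀ x₀ hx₀).continuousAt
      rw [← hz₀] at this
      exact this.comp (f := fun p : ℝ × E => (p.1, φ.symm p.2)) (hpair (t₀, z₀) hz).continuousAt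
    refine Eventually.and ?_ (Eventually.and ?_ (Eventually.and ?_ ?_))
    · exact continuousAt_fst.eventually (hJ.mem_nhds ht₀)
    · exact continuousAt_snd.eventually ((isOpen_extChartAt_target x₀).mem_nhds hz)
    · refine c1.eventually (hU.mem_nhds ?_)
      simpa only [hz₀] using hx₀
    · refine c2.eventually ?_
      simp only [hz₀]
      exact extChartAt_source_mem_nhds x₁
  have hfsmooth : ∀ᶠ p in 𝓝 (t₀, z₀), ContDiffAt ℝ ∞ f p := by
    filter_upwards [hgood] with p ⟨h1, h2, h3, h4⟩
    rw [← contMDiffAt_iff_contDiffAt]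
    have a1 : ContMDiffAt 𝓘(ℝ, ℝ × E) 𝓘(ℝ, E) ∞ (fun p : ℝ × E => Φ p.1 (φ.symm p.2)) p :=
      (hΦat p.1 h1 _ h3).comp p (hpair p h2)
    have a2 : ContMDiffAt 𝓘(ℝ, E) 𝓘(ℝ, E) ∞ ψ (Φ p.1 (φ.symm p.2)) :=
      contMDiffAt_extChartAt' (by rwa [← extChartAt_source 𝓘(ℝ, E)])
    exact a2.comp p a1
  let Xh := chartField x₁ X
  have hcurve : ∀ s ∈ J, ∀ y ∈ U, Φ s y ∈ ψ.source →
      HasDerivAt (fun r => ψ (Φ r y)) (Xh (ψ (Φ s y))) s := by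
    intro s hs y hy hsrc
    have a1 := (hint y hy s hs).hasMFDerivAt (hJ.mem_nhds hs)
    have a2 : MDifferentiableAt 𝓘(ℝ, E) 𝓘(ℝ, E) ψ (Φ s y) :=
      mdifferentiableAt_extChartAt (by rwa [← extChartAt_source 𝓘(ℝ, E)])
    have a3 : HasFDerivAt (fun r => ψ (Φ r y)) ((chartDeriv (E := E) x₁ (Φ s y)).comp
        ((1 : ℝ →L[ℝ] ℝ).smulRight (X (Φ s y) : E))) s :=
      (a2.hasMFDerivAt.comp s a1).hasFDerivAt
    have a4 := a3.hasDerivAt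
    refine a4.congr_deriv ?_
    refine Eq.trans ?_ (chartField_apply hsrc X).symm
    change chartDeriv (E := E) x₁ (Φ s y) ((1 : ℝ) • X (Φ s y)) = _
    rw [one_smul]
  have hode : ∀ᶠ p in 𝓝 (t₀, z₀), fderiv ℝ f p (1, 0) = Xh (f p) := by
    filter_upwards [hgood, hfsmooth] with p ⟨h1, h2, h3, h4⟩ hp
    have b1 : HasDerivAt (fun s : ℝ => (s, p.2)) ((1 : ℝ), (0 : E)) p.1 :=
      (hasDerivAt_id p.1).prodMk (hasDerivAt_const p.1 p.2)
    have b2 : HasFDerivAt f (fderiv ℝ f p) (p.1, p.2) :=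
      (hp.differentiableAt (by simp)).hasFDerivAt
    have b2 : HasDerivAt (fun s => f (s, p.2)) (fderiv ℝ f p (1, 0)) p.1 :=
      HasFDerivAt.comp_hasDerivAt (f := fun s : ℝ => (s, p.2)) p.1 b2 b1
    exact b2.unique (hcurve p.1 h1 _ h3 h4)
  have hslice : Tendsto (fun s : ℝ => (s, z₀)) (𝓝 t₀) (𝓝 (t₀, z₀)) :=
    (continuous_id.prodMk continuous_const).tendsto t₀
  have hgood' := hslice.eventually hgood
  have hgood'' : ∀ᶠ s in 𝓝 t₀, s ∈ J ∧ Φ s x₀ ∈ ψ.source := by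
    filter_upwards [hgood'] with s ⟨h1, _, _, h4⟩
    simp only [hz₀] at h4
    exact ⟨h1, h4⟩
  have hXh : ContDiffAt ℝ ∞ Xh (ψ x₁) := contDiffAt_chartField (hX x₁)
  have hft₀ : f (t₀, z₀) = ψ x₁ := hfz t₀
  have hfc : ContinuousAt (fun s => f (s, z₀)) t₀ :=
    (hfsmooth.self_of_nhds.continuousAt).comp (f := fun s : ℝ => (s, z₀)) hslice
  have hfderiv : ∀ᶠ s in 𝓝 t₀, (fderiv ℝ f (s, z₀)).comp (ContinuousLinearMap.inr ℝ ℝ E) =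
      (chartDeriv x₁ (Φ s x₀)).comp (flowDeriv Φ x₀ s) := by
    filter_upwards [hgood'', hslice.eventually hfsmooth] with s ⟨hs, hsrc⟩ hfs
    have c1 : HasFDerivAt (fun z => f (s, z))
        ((fderiv ℝ f (s, z₀)).comp (ContinuousLinearMap.inr ℝ ℝ E)) z₀ :=
      ((hfs.differentiableAt (by simp)).hasFDerivAt).comp z₀
        (f := fun z : E => (s, z)) (hasFDerivAt_prodMk_right s z₀)
    have c2 : HasMFDerivAt 𝓘(ℝ, E) 𝓘(ℝ, E) φ x₀ (chartDeriv (E := E) x₀ x₀) :=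
      (mdifferentiableAt_extChartAt (mem_chart_source E x₀)).hasMFDerivAt
    have c3 := (c1.hasMFDerivAt : HasMFDerivAt 𝓘(ℝ, E) 𝓘(ℝ, E) (fun z => f (s, z)) (φ x₀) _).comp
      x₀ c2
    have c4 : MDifferentiableAt 𝓘(ℝ, E) 𝓘(ℝ, E) (Φ s) x₀ := by
      have : ContMDiffAt 𝓘(ℝ, E) 𝓘(ℝ, E) ∞ (Φ s) x₀ :=
        (hΦat s hs x₀ hx₀).comp x₀ (f := fun y : M => (s, y))
          (contMDiffAt_const.prodMk contMDiffAt_id)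
      exact this.mdifferentiableAt (by simp)
    have c5 : MDifferentiableAt 𝓘(ℝ, E) 𝓘(ℝ, E) ψ (Φ s x₀) :=
      mdifferentiableAt_extChartAt (by rwa [← extChartAt_source 𝓘(ℝ, E)])
    have c6 := c5.hasMFDerivAt.comp x₀ c4.hasMFDerivAt
    have c7 : (ψ ∘ Φ s) =ᶠ[𝓝 x₀] ((fun z => f (s, z)) ∘ φ) := by
      filter_upwards [extChartAt_source_mem_nhds (I := 𝓘(ℝ, E)) x₀] with y hy
      simp only [f, Function.comp]
      rw [show φ.symm (φ y) = y from φ.left_inv hy]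
    have c8 := hasMFDerivAt_unique c6 (c3.congr_of_eventuallyEq c7)
    refine Eq.trans ?_ c8.symm
    rw [chartDeriv_self]
    rfl
  -- A is the Jacobian of X in the chart, along the trajectory. It drives the linearised flow and,
  -- with the bracket as extra term, every vector field along the trajectory.
  refine ⟨fun s => fderiv ℝ Xh (f (s, z₀)), ?_, ?_, ?_, ?_⟩
  · have : ContinuousAt (fderiv ℝ Xh) (f (t₀, z₀)) := by
      rw [hft₀]
      exact (hXh.fderiv_right (m := 0) (by norm_num)).continuousAt
    exact this.comp (f := fun s => f (s, z₀)) hfc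
  · filter_upwards [hgood''] with s hs
    exact chartDeriv_injective hs.2
  · have hXev : ∀ᶠ s in 𝓝 t₀, DifferentiableAt ℝ Xh (f (s, z₀)) := by
      have : ∀ᶠ z in 𝓝 (f (t₀, z₀)), DifferentiableAt ℝ Xh z := by
        rw [hft₀]
        exact ((hXh.of_le (m := 1) (by norm_num)).eventually (by simp)).mono
          fun z hz => hz.differentiableAt (by norm_num)
      exact hfc.eventually this
    filter_upwards [hXev, hslice.eventually hfsmooth, hslice.eventually hode.eventually_nhds,
      hfderiv.eventually_nhds] with s h1 h2 h3 h4
    have h5 := hasDerivAt_variational (h2.of_le (WithTop.coe_le_coe.2 le_top)) h1 h3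
    have h6 := h4.self_of_nhds
    rw [h6] at h5
    exact h5.congr_of_eventuallyEq (EventuallyEq.symm h4)
  · intro Y hY
    have hYh := contDiffAt_chartField hY
    have d1 := hcurve t₀ ht₀ x₀ hx₀ (mem_extChartAt_source x₁)
    have d2 : HasDerivAt (fun s => chartField x₁ Y (ψ (Φ s x₀)))
        (fderiv ℝ (chartField x₁ Y) (ψ x₁) (Xh (ψ x₁))) t₀ :=
      ((hYh.differentiableAt (by simp)).hasFDerivAt).comp_hasDerivAt t₀ d1
    have d3 : (fun s => chartDeriv (E := E) x₁ (Φ s x₀) (Y (Φ s x₀))) =ᶠ[𝓝 t₀]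
        fun s => chartField x₁ Y (ψ (Φ s x₀)) := by
      filter_upwards [hgood''] with s hs
      exact (chartField_apply hs.2 Y).symm
    refine (d2.congr_of_eventuallyEq d3).congr_deriv ?_
    rw [chartDeriv_bracket]
    have d4 : chartDeriv (E := E) x₁ x₁ (Y x₁) = chartField x₁ Y (ψ x₁) :=
      (chartField_apply (mem_extChartAt_source x₁) Y).symm
    have d5 : fderiv ℝ Xh (f (t₀, z₀)) (chartDeriv (E := E) x₁ x₁ (Y x₁)) =
        fderiv ℝ Xh (ψ x₁) (chartField x₁ Y (ψ x₁)) := by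
      rw [hft₀]
      exact congrArg _ d4
    exact ((congrArg _ d5).trans (sub_add_cancel _ _)).symm

end FlowChart

/-! ### Transport back along the flow -/

section Pull

theorem isInvertible_of_injective {E : Type*} [NormedAddCommGroup E] [NormedSpace ℝ E]
    [FiniteDimensional ℝ E] (T : E →L[ℝ] E) (h : Function.Injective T) : T.IsInvertible :=
  ⟨(LinearEquiv.ofInjectiveEndo T.toLinearMap h).toContinuousLinearEquiv, by ext; rfl⟩

variable {E : Type*} [NormedAddCommGroup E] [NormedSpace ℝ E]
  {M : Type*} [TopologicalSpace M] [ChartedSpace E M] [IsManifold 𝓘(ℝ, E) ∞ M]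

/-- `Φ` is the smooth local flow of the smooth vector field `X` on `J × U`, where `x₀ ∈ U`. -/
structure IsFlowBox (X : VField E M) (Φ : ℝ → M → M) (J : Set ℝ) (U : Set M) (x₀ : M) : Prop where
  smooth_field : ∀ x, SmoothAt X x
  isOpen_times : IsOpen J
  isOpen_space : IsOpen U
  mem : x₀ ∈ U
  smooth : ContMDiffOn (𝓘(ℝ, ℝ).prod 𝓘(ℝ, E)) 𝓘(ℝ, E) ∞ (fun p : ℝ × M => Φ p.1 p.2) (J ×ˢ U)
  initial : ∀ y ∈ U, Φ 0 y = y
  integral : ∀ y ∈ U, IsMIntegralCurveOn (fun s => Φ s y) X J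

/-- The inverse of the differential of the flow, by which tangent vectors along the trajectory of
`x₀` are transported back to `x₀`. -/
noncomputable def pull (Φ : ℝ → M → M) (x₀ : M) (t : ℝ) : E →L[ℝ] E :=
  (flowDeriv (E := E) Φ x₀ t).inverse

namespace IsFlowBox

variable {X : VField E M} {Φ : ℝ → M → M} {J : Set ℝ} {U : Set M} {x₀ : M} {t₀ : ℝ}

theorem flowDeriv_zero (hB : IsFlowBox X Φ J U x₀) :
    flowDeriv (E := E) Φ x₀ 0 = ContinuousLinearMap.id ℝ E := by
  have h1 : Φ 0 =ᶠ[𝓝 x₀] id := by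
    filter_upwards [hB.isOpen_space.mem_nhds hB.mem] with y hy using hB.initial y hy
  exact ((hasMFDerivAt_id x₀).congr_of_eventuallyEq h1).mfderiv

variable [FiniteDimensional ℝ E]

/-- In a chart the image of v under the flow differential solves a linear differential equation, so
a zero at one time spreads to nearby times. -/
theorem locally_ker (hB : IsFlowBox X Φ J U x₀) (ht₀ : t₀ ∈ J) :
    ∃ N ∈ 𝓝 t₀, ∀ t₁ ∈ N, ∀ t ∈ N, ∀ v : E,
      flowDeriv (E := E) Φ x₀ t₁ v = 0 → flowDeriv (E := E) Φ x₀ t v = 0 := by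
  obtain ⟨A, hA, hinj, hode, -⟩ := exists_flow_chart hB.smooth_field hB.isOpen_times
    hB.isOpen_space hB.mem hB.smooth hB.integral ht₀
  obtain ⟨N, hN, hNS, h⟩ := eventually_eq_zero_of_linear_ode hA (inter_mem hinj hode)
  refine ⟨N, hN, fun t₁ ht₁ t ht v hv => ?_⟩
  have h1 := h (fun s => chartDeriv (E := E) (Φ t₀ x₀) (Φ s x₀) (flowDeriv (E := E) Φ x₀ s v))
    (fun s hs => by
      have := hs.2.clm_apply (hasDerivAt_const s v)
      simpa using this) t₁ ht₁ (by rw [hv, map_zero]) t ht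
  exact (hNS ht).1 (by rw [h1, map_zero])

/-- Injectivity spreads from the identity at time 0 by connectedness, which avoids the inverse flow
and its domain. -/
theorem isInvertible (hB : IsFlowBox X Φ J U x₀) {τ : ℝ} (hτ : Icc 0 τ ⊆ J) {t : ℝ}
    (ht : t ∈ Icc 0 τ) : (flowDeriv (E := E) Φ x₀ t).IsInvertible := by
  refine isInvertible_of_injective _ ?_
  refine propagate (τ := τ) (Q := fun t => Function.Injective (flowDeriv (E := E) Φ x₀ t)) ?_
    ⟨le_rfl, ht.1.trans ht.2⟩ ht ?_
  · intro t₀ ht₀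
    obtain ⟨N, hN, h⟩ := hB.locally_ker (hτ ht₀)
    refine ⟨N, hN, fun t₁ ht₁ t ht _ _ hinj => ?_⟩
    rw [injective_iff_map_eq_zero]
    intro v hv
    exact hinj ((h t ht t₁ ht₁ v hv).trans (map_zero _).symm)
  · intro v v' h
    simpa [hB.flowDeriv_zero] using h

theorem eventually_isInvertible (hB : IsFlowBox X Φ J U x₀) (ht₀ : t₀ ∈ J)
    (hinv : (flowDeriv (E := E) Φ x₀ t₀).IsInvertible) :
    ∀ᶠ t in 𝓝 t₀, t ∈ J ∧ (flowDeriv (E := E) Φ x₀ t).IsInvertible := by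
  obtain ⟨N, hN, h⟩ := hB.locally_ker ht₀
  filter_upwards [hN, hB.isOpen_times.mem_nhds ht₀] with t ht htJ
  refine ⟨htJ, isInvertible_of_injective _ ?_⟩
  rw [injective_iff_map_eq_zero]
  intro v hv
  exact hinv.injective ((h t ht t₀ (mem_of_mem_nhds hN) v hv).trans (map_zero _).symm)

/-- The derivative of a vector field transported back along the flow is the transported Lie
bracket. -/
theorem hasDerivAt_pull (hB : IsFlowBox X Φ J U x₀) (ht₀ : t₀ ∈ J)
    (hinv : (flowDeriv (E := E) Φ x₀ t₀).IsInvertible) {Y : VField E M}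
    (hY : SmoothAt Y (Φ t₀ x₀)) :
    HasDerivAt (fun t => pull (E := E) Φ x₀ t (Y (Φ t x₀)))
      (pull (E := E) Φ x₀ t₀ (bracket X Y (Φ t₀ x₀))) t₀ := by
  obtain ⟨A, -, hinj, hode, hder⟩ := exists_flow_chart hB.smooth_field hB.isOpen_times
    hB.isOpen_space hB.mem hB.smooth hB.integral ht₀
  have hder := hder Y hY
  have hode := hode.self_of_nhds
  set R : ℝ → E →L[ℝ] E := fun s => chartDeriv (Φ t₀ x₀) (Φ s x₀) with hR
  have hR₀ : R t₀ = ContinuousLinearMap.id ℝ E := chartDeriv_self _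
  let T : ℝ → E →L[ℝ] E := fun s => (R s).comp (flowDeriv Φ x₀ s)
  have hT₀ : T t₀ = flowDeriv Φ x₀ t₀ := by
    simp only [T, hR₀, ContinuousLinearMap.id_comp]
  have hTinv : (T t₀).IsInvertible := hT₀ ▸ hinv
  let a : ℝ → E := fun s => (T s).inverse (R s (Y (Φ s x₀)))
  have hdiff : DifferentiableAt ℝ a t₀ := by
    have h1 : DifferentiableAt ℝ ContinuousLinearMap.inverse (T t₀) :=
      (hTinv.contDiffAt_map_inverse (n := 1)).differentiableAt (by norm_num)
    exact (h1.comp t₀ hode.differentiableAt).clm_apply hder.differentiableAt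
  have hTev : ∀ᶠ s in 𝓝 t₀, (T s).IsInvertible := by
    obtain ⟨e, he⟩ := hTinv
    have := hode.continuousAt.eventually
      (show range ((↑) : (E ≃L[ℝ] E) → E →L[ℝ] E) ∈ 𝓝 (T t₀) from he ▸ e.nhds)
    exact this
  have hprod : HasDerivAt (fun s => T s (a s))
      (((A t₀).comp (T t₀)) (a t₀) + T t₀ (deriv a t₀)) t₀ :=
    hode.clm_apply hdiff.hasDerivAt
  have heq : (fun s => T s (a s)) =ᶠ[𝓝 t₀] fun s => R s (Y (Φ s x₀)) := by
    filter_upwards [hTev] with s hs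
    exact hs.self_apply_inverse _
  -- (T a)' = A T a + T a' is compared with (R Y)' = R [X,Y] + A R Y. Since T a = R Y, the terms
  -- with A cancel and T a' = R [X,Y].
  have h3 := (hprod.congr_of_eventuallyEq heq.symm).unique hder
  have h4 : T t₀ (a t₀) = R t₀ (Y (Φ t₀ x₀)) := heq.self_of_nhds
  have h5 : T t₀ (deriv a t₀) = R t₀ (bracket X Y (Φ t₀ x₀)) := by
    rw [ContinuousLinearMap.comp_apply, h4, add_comm] at h3
    exact add_right_cancel h3
  have h6 : deriv a t₀ = pull (E := E) Φ x₀ t₀ (bracket X Y (Φ t₀ x₀)) := by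
    symm
    refine hinv.inverse_apply_eq.2 ?_
    rw [hR₀, hT₀] at h5
    exact h5.symm
  have h7 : (fun t => pull (E := E) Φ x₀ t (Y (Φ t x₀))) =ᶠ[𝓝 t₀] a := by
    filter_upwards [hinj] with s hs
    have h8 := isInvertible_of_injective _ hs
    refine Eq.symm ((h8.inverse_comp_apply_of_left (f := flowDeriv Φ x₀ s)).trans ?_)
    exact congrArg _ (h8.inverse_apply_self _)
  rw [← h6]
  exact hdiff.hasDerivAt.congr_of_eventuallyEq h7

end IsFlowBox

end Pull

/-! ### Smooth vector fields and their coefficients -/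

section Frames

variable {E : Type*} [NormedAddCommGroup E] [NormedSpace ℝ E]
  {M : Type*} [TopologicalSpace M] [ChartedSpace E M]

/-- The values at `y` of a family of vector fields. -/
def valuesAt {ι : Type*} (W : ι → VField E M) (y : M) : ι → E := fun i => W i y

/-- The family of brackets `[X, W_i]`. -/
noncomputable abbrev brackets {ι : Type*} (X : VField E M) (W : ι → VField E M) : ι → VField E M :=
  fun i => bracket X (W i)

/-- The combination `∑ i, f_i W_i` of vector fields with function coefficients. -/
noncomputable def fieldComb {ι : Type*} [Fintype ι] (W : ι → VField E M) (f : M → ι → ℝ) :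
    VField E M :=
  fun y => (comb (valuesAt W y) (f y) : E)

/-- The derivatives along `X` of the components of `f`. -/
noncomputable def fieldDeriv {ι : Type*} (X : VField E M) (f : M → ι → ℝ) (x : M) : ι → ℝ :=
  fun i => mfderiv 𝓘(ℝ, E) 𝓘(ℝ, ℝ) (fun y => f y i) x (X x)

variable [IsManifold 𝓘(ℝ, E) ∞ M]

theorem SmoothOn.smoothAt {Y : VField E M} {U : Set M} (h : SmoothOn Y U) (hU : IsOpen U) {x : M}
    (hx : x ∈ U) : SmoothAt Y x :=
  h.contMDiffAt (hU.mem_nhds hx)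

theorem smoothOn_of_smoothAt {Y : VField E M} {U : Set M} (h : ∀ x ∈ U, SmoothAt Y x) :
    SmoothOn Y U :=
  fun x hx => (h x hx).contMDiffWithinAt

theorem isLocalSection_of_eventually {Δ : PlaneField E M} {Y : VField E M} {x : M}
    (h : ∀ᶠ y in 𝓝 x, SmoothAt Y y ∧ Y y ∈ Δ y) : IsLocalSection Δ Y x := by
  obtain ⟨U, hU, hUo, hxU⟩ := eventually_nhds_iff.1 h
  exact ⟨U, hUo, hxU, smoothOn_of_smoothAt fun y hy => (hU y hy).1, fun y hy => (hU y hy).2⟩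

theorem IsLocalSection.eventually {Δ : PlaneField E M} {Y : VField E M} {x : M}
    (h : IsLocalSection Δ Y x) : ∀ᶠ y in 𝓝 x, SmoothAt Y y ∧ Y y ∈ Δ y := by
  obtain ⟨U, hU, hxU, hs, hm⟩ := h
  filter_upwards [hU.mem_nhds hxU] with y hy
  exact ⟨hs.smoothAt hU hy, hm y hy⟩

theorem contMDiffAt_chartDeriv {x y : M} (hy : y ∈ (chartAt E x).source) {Y : VField E M}
    (hY : SmoothAt Y y) :
    ContMDiffAt 𝓘(ℝ, E) 𝓘(ℝ, E) ∞ (fun z => chartDeriv (E := E) x z (Y z)) y := by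
  let e := trivializationAt E (TangentSpace 𝓘(ℝ, E) : M → Type _) x
  have hbase : e.baseSet = (chartAt E x).source := TangentBundle.trivializationAt_baseSet x
  have h := (e.contMDiffAt_section_iff (by rw [hbase]; exact hy)).1 hY
  refine h.congr_of_eventuallyEq ?_
  filter_upwards [(chartAt E x).open_source.mem_nhds hy] with z hz
  have h1 := TangentBundle.continuousLinearMapAt_trivializationAt (I := 𝓘(ℝ, E)) hz
  have h2 := DFunLike.congr_fun h1 (Y z)
  refine Eq.trans h2.symm ?_
  rw [Bundle.Trivialization.continuousLinearMapAt_apply,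
    Bundle.Trivialization.linearMapAt_apply, if_pos (by rw [hbase]; exact hz)]

theorem SmoothAt.fieldComb {ι : Type*} [Fintype ι] {W : ι → VField E M} {f : M → ι → ℝ} {x : M}
    (hW : ∀ i, SmoothAt (W i) x)
    (hf : ∀ i, ContMDiffAt 𝓘(ℝ, E) 𝓘(ℝ, ℝ) ∞ (fun y => f y i) x) : SmoothAt (fieldComb W f) x := by
  have h := ContMDiffAt.sum_section (s := Finset.univ)
    (fun i _ => (hf i).smul_section (hW i))
  refine h.congr_of_eventuallyEq (Eventually.of_forall fun y => ?_)
  have : DynPair.fieldComb W f y = ∑ i, f y i • W i y := comb_apply (F := E) _ _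
  simp only [this]
  rfl

variable [FiniteDimensional ℝ E]

theorem SmoothAt.bracket {X Y : VField E M} {x : M} (hX : SmoothAt X x) (hY : SmoothAt Y x) :
    SmoothAt (bracket X Y) x := by
  have : IsManifold 𝓘(ℝ, E) (((⊤ : ℕ∞) : WithTop ℕ∞) + 1) M := by
    simpa using (inferInstance : IsManifold 𝓘(ℝ, E) ∞ M)
  have : IsManifold 𝓘(ℝ, E) (minSmoothness ℝ 2) M := by
    rw [minSmoothness_of_isRCLikeNormedField]
    exact IsManifold.of_le (n := ∞) (WithTop.coe_le_coe.2 le_top)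
  exact ContMDiffAt.mlieBracket_vectorField (n := ⊤) (m := ⊤) hX hY (by simp)

/-- The coefficients of a smooth vector field with respect to linearly independent smooth vector
fields are smooth. -/
theorem exists_field_coefficients {ι : Type*} [Fintype ι] {Z : ι → VField E M} {Y : VField E M}
    {x : M} (hZ : ∀ᶠ y in 𝓝 x, ∀ i, SmoothAt (Z i) y)
    (hli : LinearIndependent ℝ (valuesAt Z x)) (hY : ∀ᶠ y in 𝓝 x, SmoothAt Y y)
    (hmem : ∀ᶠ y in 𝓝 x, ∃ c, (Y y : E) = comb (valuesAt Z y) c) :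
    ∃ f : M → ι → ℝ, ∀ᶠ y in 𝓝 x, (∀ i, ContMDiffAt 𝓘(ℝ, E) 𝓘(ℝ, ℝ) ∞ (fun z => f z i) y) ∧
      Y y = fieldComb Z f y := by
  obtain ⟨φ, hφ⟩ := exists_smooth_coefficients hli
  -- The chart at x turns the fields into functions with values in E. Its differential at x is the
  -- identity, so the smooth coefficient map built from the values at x applies.
  let A : M → ι → E := fun y i => chartDeriv (E := E) x y (Z i y)
  have hA : ∀ y ∈ (chartAt E x).source, (∀ i, SmoothAt (Z i) y) →
      ContMDiffAt 𝓘(ℝ, E) 𝓘(ℝ, ι → E) ∞ A y := fun y hy h =>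
    contMDiffAt_pi_space.2 fun i => contMDiffAt_chartDeriv hy (h i)
  have hA₀ : A x = valuesAt Z x := by
    funext i
    exact DFunLike.congr_fun (chartDeriv_self (E := E) x) (Z i x)
  have hφ' : ∀ᶠ y in 𝓝 x, (∀ s, ContDiffAt ℝ ∞ φ (A y, s)) ∧
      ∀ c : ι → ℝ, φ (A y, ∑ i, c i • A y i) = c := by
    have := (hA x (mem_chart_source E x) hZ.self_of_nhds).continuousAt
    rw [ContinuousAt, hA₀] at this
    exact this.eventually hφ
  refine ⟨fun y => φ (A y, chartDeriv (E := E) x y (Y y)), ?_⟩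
  filter_upwards [hφ', hZ, hY, hmem,
    (chartAt E x).open_source.mem_nhds (mem_chart_source E x)] with y hφy hZy hYy ⟨c, hc⟩ hy
  constructor
  · have h1 : ContMDiffAt 𝓘(ℝ, E) 𝓘(ℝ, (ι → E) × E) ∞
        (fun z => (A z, chartDeriv (E := E) x z (Y z))) y :=
      (hA y hy hZy).prodMk_space (contMDiffAt_chartDeriv hy hYy)
    have h2 := ContMDiffAt.comp (g := φ) (f := fun z => (A z, chartDeriv (E := E) x z (Y z))) y
      (hφy.1 _).contMDiffAt h1
    exact contMDiffAt_pi_space.1 h2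
  · have h1 : chartDeriv (E := E) x y (Y y) = ∑ i, c i • A y i := by
      rw [hc, comb_apply, map_sum]
      simp only [map_smul]
      rfl
    have h2 : φ (A y, chartDeriv (E := E) x y (Y y)) = c := by rw [h1]; exact hφy.2 c
    change (Y y : E) = comb (valuesAt Z y) (φ (A y, chartDeriv (E := E) x y (Y y)))
    rw [h2, hc]

/-- The Leibniz rule for the bracket with a combination of vector fields. -/
theorem bracket_fieldComb {ι : Type*} [Fintype ι] (X : VField E M) {W : ι → VField E M}
    {f : M → ι → ℝ} {x : M} (hW : ∀ i, SmoothAt (W i) x)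
    (hf : ∀ i, ContMDiffAt 𝓘(ℝ, E) 𝓘(ℝ, ℝ) ∞ (fun y => f y i) x) {Y : VField E M}
    (hY : ∀ᶠ y in 𝓝 x, Y y = fieldComb W f y) :
    (bracket X Y x : E) = comb (valuesAt W x) (fieldDeriv X f x) +
      comb (valuesAt (brackets X W) x) (f x) := by
  classical
  have h1 : bracket X Y x = bracket X (fieldComb W f) x :=
    Filter.EventuallyEq.mlieBracket_vectorField_eq (Filter.EventuallyEq.refl _ X) hY
  have hsum : ∀ s : Finset ι,
      (bracket X (fun y => ∑ i ∈ s, f y i • W i y) x : E) =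
        ∑ i ∈ s, (fieldDeriv X f x i • (W i x : E) + f x i • (bracket X (W i) x : E)) := by
    intro s
    induction s using Finset.induction_on with
    | empty =>
      simp only [Finset.sum_empty]
      exact congrFun (VectorField.mlieBracket_zero_right (I := 𝓘(ℝ, E)) (W := X)) x
    | insert j s hj ih =>
      rw [Finset.sum_insert hj, ← ih]
      have hfW : ∀ i, MDifferentiableAt 𝓘(ℝ, E) 𝓘(ℝ, E).tangent
          (fun y => (⟨y, f y i • W i y⟩ : TangentBundle 𝓘(ℝ, E) M)) x := fun i =>
        ((hf i).smul_section (hW i)).mdifferentiableAt (by simp)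
      have hs : MDifferentiableAt 𝓘(ℝ, E) 𝓘(ℝ, E).tangent
          (fun y => (⟨y, ∑ i ∈ s, f y i • W i y⟩ : TangentBundle 𝓘(ℝ, E) M)) x :=
        MDifferentiableAt.sum_section fun i _ => hfW i
      have h2 := VectorField.mlieBracket_add_right (I := 𝓘(ℝ, E)) (V := X) (hfW j) hs
      have h3 := VectorField.mlieBracket_smul_right (I := 𝓘(ℝ, E)) (V := X)
        ((hf j).mdifferentiableAt (by simp)) ((hW j).mdifferentiableAt (by simp))
      have h4 : (fun y => ∑ i ∈ insert j s, f y i • W i y) =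
          ((fun y => f y j • W j y) + fun y => ∑ i ∈ s, f y i • W i y : VField E M) := by
        funext y
        rw [Finset.sum_insert hj]
        rfl
      rw [h4]
      refine Eq.trans h2 ?_
      refine congrArg₂ (· + ·) ?_ rfl
      exact h3
  have h2 : fieldComb W f = fun y => ∑ i, f y i • W i y := by
    funext y
    exact comb_apply (F := E) _ _
  rw [h1, h2]
  refine (hsum Finset.univ).trans ?_
  rw [Finset.sum_add_distrib, comb_apply, comb_apply]
  rfl

end Frames

/-! ### Regular pairs: the derived distribution and structure matrices -/

section Structure

variable {E : Type*} [NormedAddCommGroup E] [NormedSpace ℝ E]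
  {M : Type*} [TopologicalSpace M] [ChartedSpace E M]
  [IsManifold 𝓘(ℝ, E) ∞ M]
  {m : ℕ} {X : VField E M} {V : PlaneField E M} {W : Fin m → VField E M} {U : Set M} {x : M}

theorem IsFrameOn.mem_iff (hW : IsFrameOn V W U) (hx : x ∈ U) {v : TangentSpace 𝓘(ℝ, E) x} :
    v ∈ V x ↔ ∃ a, (v : E) = comb (valuesAt W x) a := by
  rw [← hW.span_eq x hx]
  have h := range_comb (F := TangentSpace 𝓘(ℝ, E) x) (fun i => W i x)
  rw [← h]
  exact ⟨fun ⟨a, ha⟩ => ⟨a, ha.symm⟩, fun ⟨a, ha⟩ => ⟨a, ha.symm⟩⟩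

theorem IsFrameOn.mono (hW : IsFrameOn V W U) {U' : Set M} (hU' : IsOpen U') (h : U' ⊆ U) :
    IsFrameOn V W U' where
  isOpen := hU'
  smooth i := (hW.smooth i).mono h
  linearIndependent y hy := hW.linearIndependent y (h hy)
  span_eq y hy := hW.span_eq y (h hy)

theorem IsRegularPair.smoothAt (hreg : IsRegularPair m X V) (x : M) : SmoothAt X x :=
  hreg.smooth.smoothAt isOpen_univ (mem_univ x)

theorem IsFrameOn.smoothAt (hW : IsFrameOn V W U) (hx : x ∈ U) (i : Fin m) : SmoothAt (W i) x :=
  (hW.smooth i).smoothAt hW.isOpen hx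

theorem IsFrameOn.isLocalSection (hW : IsFrameOn V W U) (hx : x ∈ U) (i : Fin m) :
    IsLocalSection V (W i) x := by
  refine ⟨U, hW.isOpen, hx, hW.smooth i, fun y hy => ?_⟩
  rw [← hW.span_eq y hy]
  exact Submodule.subset_span ⟨i, rfl⟩

variable [FiniteDimensional ℝ E]

theorem IsFrameOn.smoothAt_bracket (hW : IsFrameOn V W U) (hreg : IsRegularPair m X V)
    (hx : x ∈ U) (i : Fin m) : SmoothAt (bracket X (W i)) x :=
  (hreg.smoothAt x).bracket (hW.smoothAt hx i)

/-- A local section of `V` has smooth coefficients with respect to a frame. -/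
theorem IsFrameOn.exists_coefficients (hW : IsFrameOn V W U) (hx : x ∈ U) {Y : VField E M}
    (hY : IsLocalSection V Y x) : ∃ f : M → Fin m → ℝ, ∀ᶠ y in 𝓝 x,
      (∀ i, ContMDiffAt 𝓘(ℝ, E) 𝓘(ℝ, ℝ) ∞ (fun z => f z i) y) ∧ Y y = fieldComb W f y := by
  have hU := hW.isOpen.mem_nhds hx
  refine exists_field_coefficients ?_ (hW.linearIndependent x hx)
    (hY.eventually.mono fun y hy => hy.1) ?_
  · filter_upwards [hU] with y hy i using hW.smoothAt hy i
  · filter_upwards [hU, hY.eventually] with y hy hYy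
    exact (hW.mem_iff hy).1 hYy.2

/-- By the Leibniz rule the bracket of X with ∑ f_i W_i is a combination of the W_i and [X,W_i], so
arbitrary local sections add nothing to one frame. -/
theorem IsFrameOn.mem_derived_iff (hW : IsFrameOn V W U) (hx : x ∈ U)
    {v : TangentSpace 𝓘(ℝ, E) x} : v ∈ derived X V x ↔
      ∃ a b, (v : E) = comb (valuesAt W x) a + comb (valuesAt (brackets X W) x) b := by
  constructor
  · intro hv
    obtain ⟨p, hp, q, hq, rfl⟩ := Submodule.mem_sup.1 hv
    obtain ⟨a, ha⟩ := (hW.mem_iff hx).1 hp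
    suffices h : ∃ a b, (q : E) = comb (valuesAt W x) a + comb (valuesAt (brackets X W) x) b by
      obtain ⟨a', b, hq⟩ := h
      refine ⟨a + a', b, ?_⟩
      rw [map_add, add_assoc, ← hq, ← ha]
      rfl
    refine Submodule.span_induction (p := fun q _ => ∃ a b,
      (q : E) = comb (valuesAt W x) a + comb (valuesAt (brackets X W) x) b) ?_ ?_ ?_ ?_ hq
    · rintro _ ⟨Y, hY, rfl⟩
      obtain ⟨f, hf⟩ := hW.exists_coefficients hx hY
      exact ⟨_, _, bracket_fieldComb X (hW.smoothAt hx) hf.self_of_nhds.1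
        (hf.mono fun y hy => hy.2)⟩
    · exact ⟨0, 0, by simp only [map_zero, add_zero]⟩
    · rintro q q' - - ⟨a, b, h⟩ ⟨a', b', h'⟩
      refine ⟨a + a', b + b', ?_⟩
      rw [map_add, map_add, add_add_add_comm, ← h, ← h']
    · rintro r q - ⟨a, b, h⟩
      refine ⟨r • a, r • b, ?_⟩
      rw [map_smul, map_smul, ← smul_add, ← h]
      rfl
  · rintro ⟨a, b, hv⟩
    have hb : ((comb (valuesAt (brackets X W) x) b : E) : TangentSpace 𝓘(ℝ, E) x) ∈
        Submodule.span ℝ {u | ∃ W : VField E M, IsLocalSection V W x ∧ u = bracket X W x} := by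
      have h := (range_comb (F := TangentSpace 𝓘(ℝ, E) x) fun i => bracket X (W i) x).le ⟨b, rfl⟩
      refine Submodule.span_mono (M := TangentSpace 𝓘(ℝ, E) x) ?_ h
      rintro _ ⟨i, rfl⟩
      exact ⟨W i, hW.isLocalSection hx i, rfl⟩
    have ha : ((comb (valuesAt W x) a : E) : TangentSpace 𝓘(ℝ, E) x) ∈ V x :=
      (hW.mem_iff hx).2 ⟨a, rfl⟩
    have := Submodule.add_mem _ (Submodule.mem_sup_left (T := Submodule.span ℝ
      {u | ∃ W : VField E M, IsLocalSection V W x ∧ u = bracket X W x}) ha)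
      (Submodule.mem_sup_right (S := V x) hb)
    exact hv ▸ this

/-- A frame of `V` and its brackets with `X` are jointly linearly independent. -/
theorem IsFrameOn.eq_zero (hW : IsFrameOn V W U) (hreg : IsRegularPair m X V) (hx : x ∈ U)
    (a b : Fin m → ℝ)
    (h : comb (valuesAt W x) a + comb (valuesAt (brackets X W) x) b = 0) : a = 0 ∧ b = 0 := by
  let T : (Fin m → ℝ) × (Fin m → ℝ) →ₗ[ℝ] TangentSpace 𝓘(ℝ, E) x :=
    LinearMap.coprod (comb (F := TangentSpace 𝓘(ℝ, E) x) fun i => W i x)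
      (comb (F := TangentSpace 𝓘(ℝ, E) x) fun i => bracket X (W i) x)
  have hT : LinearMap.range T = derived X V x := by
    ext v
    rw [hW.mem_derived_iff hx]
    constructor
    · rintro ⟨⟨a, b⟩, rfl⟩
      exact ⟨a, b, rfl⟩
    · rintro ⟨a, b, hv⟩
      exact ⟨(a, b), hv.symm⟩
  -- The 2m vectors W_i and [X,W_i] span a space of dimension 2m, so the combination map has no
  -- kernel.
  have h1 := T.finrank_range_add_finrank_ker
  rw [hT, hreg.rank x, Module.finrank_prod, Module.finrank_fin_fun] at h1
  have h2 : Module.finrank ℝ (LinearMap.ker T) = 0 := by omega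
  have h3 : LinearMap.ker T = ⊥ := Submodule.finrank_eq_zero.1 h2
  have h4 : (a, b) ∈ LinearMap.ker T := h
  rw [h3, Submodule.mem_bot] at h4
  exact Prod.ext_iff.1 h4

/-- Near every point there is a frame of `V` with structure matrices. -/
theorem IsRegularPair.exists_structure (hreg : IsRegularPair m X V) (x : M) :
    ∃ (U : Set M) (W : Fin m → VField E M) (H₀ H₁ : M → Matrix (Fin m) (Fin m) ℝ),
      x ∈ U ∧ IsFrameOn V W U ∧ AreStructureMatrices X W H₀ H₁ U := by
  obtain ⟨U, W, hx, hW⟩ := hreg.distribution x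
  let Z : Fin m ⊕ Fin m → VField E M := Sum.elim W (brackets X W)
  have hsplit : ∀ (y : M) (c : Fin m ⊕ Fin m → ℝ), comb (valuesAt Z y) c =
      comb (valuesAt W y) (fun i => c (Sum.inl i)) +
        comb (valuesAt (brackets X W) y) (fun i => c (Sum.inr i)) := by
    intro y c
    rw [comb_apply, Fintype.sum_sum_type, comb_apply, comb_apply]
    rfl
  have hZ : ∀ y ∈ U, ∀ i, SmoothAt (Z i) y := by
    rintro y hy (i | i)
    · exact hW.smoothAt hy i
    · exact hW.smoothAt_bracket hreg hy i
  have hU := hW.isOpen.mem_nhds hx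
  have hli : LinearIndependent ℝ (valuesAt Z x) := by
    rw [Fintype.linearIndependent_iff]
    intro c hc
    rw [← comb_apply, hsplit] at hc
    obtain ⟨h1, h2⟩ := hW.eq_zero hreg hx _ _ hc
    rintro (i | i)
    · exact congrFun h1 i
    · exact congrFun h2 i
  have hex := fun j => exists_field_coefficients (Y := bracket X (bracket X (W j)))
    (by filter_upwards [hU] with y hy using hZ y hy) hli
    (by filter_upwards [hU] with y hy using (hreg.smoothAt y).bracket (hZ y hy (Sum.inr j)))
    (by
      filter_upwards [hU] with y hy
      -- [X,W_j] is a section of D, so invariance of D puts [X,[X,W_j]] in D; its coefficients are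
      -- the columns of the structure matrices.
      have h1 : IsLocalSection (derived X V) (bracket X (W j)) y := by
        refine isLocalSection_of_eventually ?_
        filter_upwards [hW.isOpen.mem_nhds hy] with z hz
        refine ⟨hW.smoothAt_bracket hreg hz j, Submodule.mem_sup_right
          (Submodule.subset_span ⟨W j, hW.isLocalSection hz j, rfl⟩)⟩
      obtain ⟨a, b, hab⟩ := (hW.mem_derived_iff hy).1 (hreg.invariant y _ h1)
      refine ⟨Sum.elim a b, ?_⟩
      rw [hsplit]
      exact hab)
  choose f hf using hex
  obtain ⟨U', hU', hU'o, hxU'⟩ := eventually_nhds_iff.1 ((eventually_all.2 hf).and hU)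
  refine ⟨U', W, fun y => Matrix.of fun i j => f j y (Sum.inl i),
    fun y => Matrix.of fun i j => f j y (Sum.inr i), hxU',
    hW.mono hU'o fun y hy => (hU' y hy).2, ?_, ?_, ?_⟩
  · exact fun i j y hy => (((hU' y hy).1 j).1 (Sum.inl i)).contMDiffWithinAt
  · exact fun i j y hy => (((hU' y hy).1 j).1 (Sum.inr i)).contMDiffWithinAt
  · intro y hy j
    refine ((hU' y hy).1 j).2.trans ?_
    refine (hsplit y (f j y)).trans ?_
    rw [comb_apply, comb_apply]
    rfl

end Structure

/-! ### Frames, horizontal space and curvature along a trajectory -/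

section Trajectory

variable {E : Type*} [NormedAddCommGroup E] [NormedSpace ℝ E]
  {M : Type*} [TopologicalSpace M] [ChartedSpace E M]

/-- The plane field `V` along the trajectory of `x₀`, transported back to `x₀` by the flow. -/
noncomputable def pulledSpace (Φ : ℝ → M → M) (x₀ : M) (V : PlaneField E M) (t : ℝ) :
    Submodule ℝ E :=
  Submodule.comap (flowDeriv (E := E) Φ x₀ t).toLinearMap (show Submodule ℝ E from V (Φ t x₀))

/-- The vector fields `W_i` along the trajectory of `x₀`, transported back to `x₀` by the flow. -/
noncomputable def pullFrame {ι : Type*} (Φ : ℝ → M → M) (x₀ : M) (W : ι → VField E M) (t : ℝ) :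
    ι → E :=
  fun i => pull (E := E) Φ x₀ t (W i (Φ t x₀))

theorem mem_pulledSpace {Φ : ℝ → M → M} {x₀ : M} {V : PlaneField E M} {t : ℝ} {v : E} :
    v ∈ pulledSpace Φ x₀ V t ↔
      (show TangentSpace 𝓘(ℝ, E) (Φ t x₀) from flowDeriv (E := E) Φ x₀ t v) ∈ V (Φ t x₀) :=
  Iff.rfl

theorem comb_pullFrame {ι : Type*} [Fintype ι] (Φ : ℝ → M → M) (x₀ : M) (W : ι → VField E M)
    (t : ℝ) (a : ι → ℝ) :
    comb (pullFrame Φ x₀ W t) a = pull (E := E) Φ x₀ t (comb (valuesAt W (Φ t x₀)) a) :=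
  (map_comb (pull (E := E) Φ x₀ t).toLinearMap (valuesAt W (Φ t x₀)) a).symm

theorem pull_mem_pulledSpace {Φ : ℝ → M → M} {x₀ : M} {V : PlaneField E M} {t : ℝ}
    (hinv : (flowDeriv (E := E) Φ x₀ t).IsInvertible)
    {v : TangentSpace 𝓘(ℝ, E) (Φ t x₀)} :
    pull (E := E) Φ x₀ t v ∈ pulledSpace Φ x₀ V t ↔ v ∈ V (Φ t x₀) := by
  rw [mem_pulledSpace]
  have : flowDeriv (E := E) Φ x₀ t (pull (E := E) Φ x₀ t v) = v := hinv.self_apply_inverse _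
  rw [this]

theorem pull_injective {Φ : ℝ → M → M} {x₀ : M} {t : ℝ}
    (hinv : (flowDeriv (E := E) Φ x₀ t).IsInvertible) :
    Function.Injective (pull (E := E) Φ x₀ t) := by
  intro v v' h
  rw [← hinv.self_apply_inverse v, ← hinv.self_apply_inverse v']
  exact congrArg _ h

variable [IsManifold 𝓘(ℝ, E) ∞ M]

/-- `W` is a frame of `V` near `x` with structure matrices `H₀` and `H₁`. -/
structure IsStructureFrame {m : ℕ} (X : VField E M) (V : PlaneField E M)
    (W : Fin m → VField E M) (H₀ H₁ : M → Matrix (Fin m) (Fin m) ℝ) (U : Set M) (x : M) : Prop where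
  mem : x ∈ U
  frame : IsFrameOn V W U
  structureMatrices : AreStructureMatrices X W H₀ H₁ U

/-- A function with prescribed value and prescribed derivative along `X` at `x`. -/
theorem exists_function_of_fieldDeriv {m : ℕ} {X : VField E M} {x : M} (hX : X x ≠ 0)
    (a α : Fin m → ℝ) :
    ∃ f : M → Fin m → ℝ, f x = a ∧ fieldDeriv X f x = α ∧
      ∀ᶠ y in 𝓝 x, ∀ i, ContMDiffAt 𝓘(ℝ, E) 𝓘(ℝ, ℝ) ∞ (fun z => f z i) y := by
  -- Nonvanishing of X gives a chart coordinate with derivative 1 along X at x; f is affine in it.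
  obtain ⟨l, hl⟩ : ∃ l : E →L[ℝ] ℝ, l (X x) = 1 :=
    SeparatingDual.exists_eq_one (show (X x : E) ≠ 0 from hX)
  let ψ : M → ℝ := fun y => l (extChartAt 𝓘(ℝ, E) x y)
  have hψ : ∀ y ∈ (chartAt E x).source, ContMDiffAt 𝓘(ℝ, E) 𝓘(ℝ, ℝ) ∞ ψ y := fun y hy =>
    l.contDiff.contMDiff.contMDiffAt.comp y (contMDiffAt_extChartAt' hy)
  have hx := mem_chart_source E x
  refine ⟨fun y i => a i + (ψ y - ψ x) * α i, ?_, ?_, ?_⟩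
  · funext i
    simp
  · funext i
    have h1 : HasMFDerivAt 𝓘(ℝ, E) 𝓘(ℝ, E) (extChartAt 𝓘(ℝ, E) x) x
        (ContinuousLinearMap.id ℝ E) := by
      have := (mdifferentiableAt_extChartAt (I := 𝓘(ℝ, E)) hx).hasMFDerivAt
      have h := chartDeriv_self (E := E) x
      rw [chartDeriv] at h
      rwa [h] at this
    have h2 : HasFDerivAt (fun z : E => a i + (l z - ψ x) * α i) (α i • l)
        (extChartAt 𝓘(ℝ, E) x x) :=
      ((l.hasFDerivAt.sub_const _).mul_const (α i)).const_add (a i)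
    have h3 := (h2.hasMFDerivAt.comp x h1).mfderiv
    refine (DFunLike.congr_fun h3 (X x)).trans ?_
    change α i • l (X x) = α i
    rw [hl, smul_eq_mul, mul_one]
  · filter_upwards [(chartAt E x).open_source.mem_nhds hx] with y hy i
    have h2 : ContDiff ℝ ∞ (fun z : ℝ => a i + (z - ψ x) * α i) := by fun_prop
    exact h2.contMDiff.contMDiffAt.comp y (hψ y hy)

theorem range_comb_pullFrame {m : ℕ} {Φ : ℝ → M → M} {x₀ : M} {V : PlaneField E M} {t : ℝ}
    {W : Fin m → VField E M} {U : Set M} (hW : IsFrameOn V W U) (hx : Φ t x₀ ∈ U)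
    (hinv : (flowDeriv (E := E) Φ x₀ t).IsInvertible) :
    LinearMap.range (comb (pullFrame Φ x₀ W t)) = pulledSpace Φ x₀ V t := by
  ext v
  constructor
  · rintro ⟨a, rfl⟩
    rw [comb_pullFrame]
    exact (pull_mem_pulledSpace hinv).2 ((hW.mem_iff hx).2 ⟨a, rfl⟩)
  · intro hv
    obtain ⟨a, ha⟩ := (hW.mem_iff hx).1 (mem_pulledSpace.1 hv)
    refine ⟨a, ?_⟩
    rw [comb_pullFrame, ← ha]
    exact hinv.inverse_apply_self v

namespace IsFlowBox

variable {m : ℕ} {X : VField E M} {V : PlaneField E M} {Φ : ℝ → M → M} {J : Set ℝ}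
  {N : Set M} {x₀ : M} {t₀ : ℝ}

theorem hasMFDerivAt (hB : IsFlowBox X Φ J N x₀) (ht₀ : t₀ ∈ J) :
    HasMFDerivAt 𝓘(ℝ, ℝ) 𝓘(ℝ, E) (fun t => Φ t x₀) t₀
      ((1 : ℝ →L[ℝ] ℝ).smulRight (X (Φ t₀ x₀))) :=
  (hB.integral x₀ hB.mem t₀ ht₀).hasMFDerivAt (hB.isOpen_times.mem_nhds ht₀)

theorem continuousAt (hB : IsFlowBox X Φ J N x₀) (ht₀ : t₀ ∈ J) :
    ContinuousAt (fun t => Φ t x₀) t₀ :=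
  (hB.hasMFDerivAt ht₀).continuousAt

theorem hasDerivAt_comp (hB : IsFlowBox X Φ J N x₀) (ht₀ : t₀ ∈ J) {f : M → ℝ}
    (hf : ContMDiffAt 𝓘(ℝ, E) 𝓘(ℝ, ℝ) ∞ f (Φ t₀ x₀)) :
    HasDerivAt (fun t => f (Φ t x₀)) (mfderiv 𝓘(ℝ, E) 𝓘(ℝ, ℝ) f (Φ t₀ x₀) (X (Φ t₀ x₀))) t₀ := by
  have h := ((hf.mdifferentiableAt (by simp)).hasMFDerivAt.comp t₀ (hB.hasMFDerivAt ht₀))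
  let A : E →L[ℝ] ℝ := mfderiv 𝓘(ℝ, E) 𝓘(ℝ, ℝ) f (Φ t₀ x₀)
  let ξ : E := X (Φ t₀ x₀)
  have h' : HasFDerivAt (fun t => f (Φ t x₀)) (A.comp ((1 : ℝ →L[ℝ] ℝ).smulRight ξ)) t₀ :=
    hasMFDerivAt_iff_hasFDerivAt.1 h
  refine h'.hasDerivAt.congr_deriv ?_
  change A ((1 : ℝ) • ξ) = A ξ
  rw [one_smul]

variable [FiniteDimensional ℝ E] {W : Fin m → VField E M}
  {H₀ H₁ : M → Matrix (Fin m) (Fin m) ℝ} {U : Set M}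

theorem eventually_isMovingFrameAt (hB : IsFlowBox X Φ J N x₀) (hreg : IsRegularPair m X V)
    (ht₀ : t₀ ∈ J) (hinv : (flowDeriv (E := E) Φ x₀ t₀).IsInvertible)
    (hS : IsStructureFrame X V W H₀ H₁ U (Φ t₀ x₀)) :
    ∀ᶠ t in 𝓝 t₀, IsMovingFrameAt (pulledSpace Φ x₀ V) (pullFrame Φ x₀ W)
      (pullFrame Φ x₀ (brackets X W)) (fun t => H₀ (Φ t x₀)) (fun t => H₁ (Φ t x₀))
      (fun t => derivAlong X H₁ (Φ t x₀)) t := by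
  obtain ⟨hmem, hW, hH⟩ := hS
  filter_upwards [hB.eventually_isInvertible ht₀ hinv,
    hB.continuousAt ht₀ (hW.isOpen.mem_nhds hmem)] with t ⟨ht, hi⟩ hx
  have hx : Φ t x₀ ∈ U := hx
  constructor
  · exact hasDerivAt_pi.2 fun i => hB.hasDerivAt_pull ht hi (hW.smoothAt hx i)
  · refine hasDerivAt_pi.2 fun i =>
      (hB.hasDerivAt_pull ht hi (hW.smoothAt_bracket hreg hx i)).congr_deriv ?_
    rw [comb_pullFrame, comb_pullFrame, ← map_add]
    refine congrArg _ ((hH.eq _ hx i).trans ?_)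
    rw [comb_apply, comb_apply]
    rfl
  · intro a b h
    refine hW.eq_zero hreg hx a b (pull_injective hi ?_)
    rw [map_add, map_zero, ← comb_pullFrame, ← comb_pullFrame]
    exact h
  · exact range_comb_pullFrame hW hx hi
  · exact fun i j => ((hH.smooth_zero i j).contMDiffAt (hW.isOpen.mem_nhds hx)).continuousAt.comp
      (f := fun t => Φ t x₀) (hB.continuousAt ht)
  · exact fun i j => hB.hasDerivAt_comp ht
      ((hH.smooth_one i j).contMDiffAt (hW.isOpen.mem_nhds hx))

/-- The curves in `E` obtained by transporting back a section of `V` and its brackets. -/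
theorem eventually_hasDerivAt_section (hB : IsFlowBox X Φ J N x₀)
    (ht₀ : t₀ ∈ J) (hinv : (flowDeriv (E := E) Φ x₀ t₀).IsInvertible) {Y : VField E M}
    (hY : IsLocalSection V Y (Φ t₀ x₀)) :
    (∀ᶠ t in 𝓝 t₀, HasDerivAt (fun t => pull (E := E) Φ x₀ t (Y (Φ t x₀)))
      (pull (E := E) Φ x₀ t (bracket X Y (Φ t x₀))) t) ∧
    (∀ᶠ t in 𝓝 t₀, HasDerivAt (fun t => pull (E := E) Φ x₀ t (bracket X Y (Φ t x₀)))
      (pull (E := E) Φ x₀ t (bracket X (bracket X Y) (Φ t x₀))) t) ∧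
    ∀ᶠ t in 𝓝 t₀, pull (E := E) Φ x₀ t (Y (Φ t x₀)) ∈ pulledSpace Φ x₀ V t := by
  have h := (hB.eventually_isInvertible ht₀ hinv).and
    ((hB.continuousAt ht₀).eventually hY.eventually)
  refine ⟨h.mono fun t ht => ?_, h.mono fun t ht => ?_, h.mono fun t ht => ?_⟩
  · exact hB.hasDerivAt_pull ht.1.1 ht.1.2 ht.2.1
  · exact hB.hasDerivAt_pull ht.1.1 ht.1.2 ((hB.smooth_field _).bracket ht.2.1)
  · exact (pull_mem_pulledSpace ht.1.2).2 ht.2.2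

/-- For Y = ∑ f_i W_i, normality at the point means X(f) = -½ H₁ f there, so [X,Y] depends only on
the value of f. -/
theorem bracket_eq_of_normal (hB : IsFlowBox X Φ J N x₀) (hreg : IsRegularPair m X V)
    (ht₀ : t₀ ∈ J) (hinv : (flowDeriv (E := E) Φ x₀ t₀).IsInvertible)
    (hS : IsStructureFrame X V W H₀ H₁ U (Φ t₀ x₀)) {Y : VField E M}
    (hY : IsNormalAt X V Y (Φ t₀ x₀)) :
    ∃ f, (bracket X Y (Φ t₀ x₀) : E) = comb (valuesAt (brackets X W) (Φ t₀ x₀)) f -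
      comb (valuesAt W (Φ t₀ x₀)) ((1 / 2 : ℝ) • (H₁ (Φ t₀ x₀) *ᵥ f)) := by
  obtain ⟨h1, h2, h3⟩ := hB.eventually_hasDerivAt_section ht₀ hinv hY.1
  obtain ⟨f, hf⟩ := deriv_eq_of_normal (hB.eventually_isMovingFrameAt hreg ht₀ hinv hS) h1 h2 h3
    ((pull_mem_pulledSpace hinv).2 hY.2)
  refine ⟨f, pull_injective hinv ?_⟩
  rw [map_sub, ← comb_pullFrame, ← comb_pullFrame]
  exact hf

/-- Normality at one point prescribes only the value and the X-derivative of the coefficients there,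
so no differential equation along X has to be solved. -/
theorem exists_normal (hB : IsFlowBox X Φ J N x₀) (hreg : IsRegularPair m X V)
    (ht₀ : t₀ ∈ J) (hinv : (flowDeriv (E := E) Φ x₀ t₀).IsInvertible)
    (hS : IsStructureFrame X V W H₀ H₁ U (Φ t₀ x₀)) (a : Fin m → ℝ) :
    ∃ Y, IsNormalAt X V Y (Φ t₀ x₀) ∧
      (bracket X Y (Φ t₀ x₀) : E) = comb (valuesAt (brackets X W) (Φ t₀ x₀)) a -
        comb (valuesAt W (Φ t₀ x₀)) ((1 / 2 : ℝ) • (H₁ (Φ t₀ x₀) *ᵥ a)) := by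
  obtain ⟨f, hfx, hfd, hfs⟩ := exists_function_of_fieldDeriv (hreg.ne_zero (Φ t₀ x₀)) a
    (-((1 / 2 : ℝ) • (H₁ (Φ t₀ x₀) *ᵥ a)))
  have hY : IsLocalSection V (fieldComb W f) (Φ t₀ x₀) := by
    refine isLocalSection_of_eventually ?_
    filter_upwards [hS.frame.isOpen.mem_nhds hS.mem, hfs] with y hy hf
    exact ⟨SmoothAt.fieldComb (hS.frame.smoothAt hy) hf, (hS.frame.mem_iff hy).2 ⟨f y, rfl⟩⟩
  have hbr := bracket_fieldComb X (Y := fieldComb W f) (hS.frame.smoothAt hS.mem)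
    hfs.self_of_nhds (Eventually.of_forall fun _ => rfl)
  rw [hfx, hfd] at hbr
  refine ⟨fieldComb W f, ⟨hY, ?_⟩, ?_⟩
  · obtain ⟨h1, h2, h3⟩ := hB.eventually_hasDerivAt_section ht₀ hinv hY
    have hF := hB.eventually_isMovingFrameAt hreg ht₀ hinv hS
    obtain ⟨k, k₁, k₂, hk⟩ := exists_section_coefficients hF h1 h2 h3
    obtain ⟨-, -, -, h4, h5⟩ := hk.self_of_nhds
    have h6 := congrArg (pull (E := E) Φ x₀ t₀) hbr
    rw [map_add, ← comb_pullFrame, ← comb_pullFrame] at h6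
    obtain ⟨h7, h8⟩ := hF.self_of_nhds.unique (h4.symm.trans h6)
    have h9 : (2 : ℝ) • k₁ t₀ + H₁ (Φ t₀ x₀) *ᵥ k t₀ = 0 := by
      rw [h7, h8, smul_neg, smul_smul]
      norm_num
    rw [h9, map_zero, add_zero] at h5
    refine (pull_mem_pulledSpace hinv).1 ?_
    rw [h5, ← hF.self_of_nhds.range_eq]
    exact ⟨_, rfl⟩
  · rw [hbr, map_neg]
    abel

theorem mem_horizontal_iff (hB : IsFlowBox X Φ J N x₀) (hreg : IsRegularPair m X V)
    (ht₀ : t₀ ∈ J) (hinv : (flowDeriv (E := E) Φ x₀ t₀).IsInvertible)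
    (hS : IsStructureFrame X V W H₀ H₁ U (Φ t₀ x₀)) {v : TangentSpace 𝓘(ℝ, E) (Φ t₀ x₀)} :
    v ∈ horizontal X V (Φ t₀ x₀) ↔
      ∃ a, (v : E) = comb (valuesAt (brackets X W) (Φ t₀ x₀)) a -
        comb (valuesAt W (Φ t₀ x₀)) ((1 / 2 : ℝ) • (H₁ (Φ t₀ x₀) *ᵥ a)) := by
  constructor
  · intro hv
    refine Submodule.span_induction (p := fun v _ => ∃ a,
      (v : E) = comb (valuesAt (brackets X W) (Φ t₀ x₀)) a -
        comb (valuesAt W (Φ t₀ x₀)) ((1 / 2 : ℝ) • (H₁ (Φ t₀ x₀) *ᵥ a))) ?_ ?_ ?_ ?_ hv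
    · rintro _ ⟨Y, hY, rfl⟩
      exact hB.bracket_eq_of_normal hreg ht₀ hinv hS hY
    · exact ⟨0, by simp only [Matrix.mulVec_zero, smul_zero, map_zero, sub_zero]⟩
    · rintro q q' - - ⟨a, h⟩ ⟨a', h'⟩
      refine ⟨a + a', ?_⟩
      rw [Matrix.mulVec_add, smul_add, map_add, map_add, add_sub_add_comm, ← h, ← h']
    · rintro r q - ⟨a, h⟩
      refine ⟨r • a, ?_⟩
      rw [Matrix.mulVec_smul, smul_comm _ r, map_smul, map_smul, ← smul_sub, ← h]
      rfl
  · rintro ⟨a, ha⟩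
    obtain ⟨Y, hY, h⟩ := hB.exists_normal hreg ht₀ hinv hS a
    exact Submodule.subset_span ⟨Y, hY, ha.trans h.symm⟩

/-- The covariant derivatives of the frame fields are given by the matrix `H₁ / 2`. -/
theorem covDeriv_frame (hB : IsFlowBox X Φ J N x₀) (hreg : IsRegularPair m X V)
    (ht₀ : t₀ ∈ J) (hinv : (flowDeriv (E := E) Φ x₀ t₀).IsInvertible)
    (hS : IsStructureFrame X V W H₀ H₁ U (Φ t₀ x₀)) (j : Fin m) :
    (covDeriv X V (W j) (Φ t₀ x₀) : E) =
      comb (valuesAt W (Φ t₀ x₀)) (((1 / 2 : ℝ) • H₁ (Φ t₀ x₀)).col j) := by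
  have hcol : ((1 / 2 : ℝ) • H₁ (Φ t₀ x₀)).col j =
      (1 / 2 : ℝ) • (H₁ (Φ t₀ x₀) *ᵥ Pi.single j 1) := by
    rw [Matrix.mulVec_single_one]
    rfl
  have hj : comb (valuesAt (brackets X W) (Φ t₀ x₀)) (Pi.single j 1) =
    bracket X (W j) (Φ t₀ x₀) := comb_single _ _
  -- The vertical part is defined by a choice. This witness shows that a choice exists; independence
  -- of W and [X,W] then shows that it is the only one.
  have hex : ∃ v, v ∈ V (Φ t₀ x₀) ∧
      bracket X (W j) (Φ t₀ x₀) - v ∈ horizontal X V (Φ t₀ x₀) := by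
    refine ⟨(comb (valuesAt W (Φ t₀ x₀)) (((1 / 2 : ℝ) • H₁ (Φ t₀ x₀)).col j) : E),
      (hS.frame.mem_iff hS.mem).2 ⟨_, rfl⟩,
      (hB.mem_horizontal_iff hreg ht₀ hinv hS).2 ⟨Pi.single j 1, ?_⟩⟩
    rw [hj, hcol]
    rfl
  have hdef : covDeriv X V (W j) (Φ t₀ x₀) = hex.choose := dif_pos hex
  obtain ⟨h1, h2⟩ := hex.choose_spec
  rw [← hdef] at h1 h2
  obtain ⟨b, hb⟩ := (hS.frame.mem_iff hS.mem).1 h1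
  obtain ⟨a, ha⟩ := (hB.mem_horizontal_iff hreg ht₀ hinv hS).1 h2
  have h3 : comb (valuesAt (brackets X W) (Φ t₀ x₀)) (Pi.single j 1) -
      comb (valuesAt W (Φ t₀ x₀)) b =
      comb (valuesAt (brackets X W) (Φ t₀ x₀)) a -
        comb (valuesAt W (Φ t₀ x₀)) ((1 / 2 : ℝ) • (H₁ (Φ t₀ x₀) *ᵥ a)) := by
    rw [← ha, ← hb, hj]
    rfl
  obtain ⟨h4, h5⟩ := hS.frame.eq_zero hreg hS.mem
    (b - (1 / 2 : ℝ) • (H₁ (Φ t₀ x₀) *ᵥ a)) (a - Pi.single j 1) (by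
      rw [map_sub, map_sub, ← neg_eq_zero, ← sub_eq_zero.2 h3]
      abel)
  rw [hb, hcol, ← sub_eq_zero.1 h5, ← sub_eq_zero.1 h4]

/-- The curvature operator is given in any structure frame by the curvature matrix. -/
theorem curvature_comb (hB : IsFlowBox X Φ J N x₀) (hreg : IsRegularPair m X V)
    (ht₀ : t₀ ∈ J) (hinv : (flowDeriv (E := E) Φ x₀ t₀).IsInvertible)
    (hS : IsStructureFrame X V W H₀ H₁ U (Φ t₀ x₀)) (b : Fin m → ℝ) :
    (curvature m X V (Φ t₀ x₀) (comb (valuesAt W (Φ t₀ x₀)) b : E) : E) =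
      comb (valuesAt W (Φ t₀ x₀)) (curvatureMatrix X H₀ H₁ (Φ t₀ x₀) *ᵥ b) := by
  have hex : ∃ w, IsCurvatureVector m X V (Φ t₀ x₀) (comb (valuesAt W (Φ t₀ x₀)) b : E) w :=
    ⟨_, U, W, H₀, H₁, b, hS.mem, hS.frame, hS.structureMatrices, comb_apply (F := E) _ _, rfl⟩
  have hdef : curvature m X V (Φ t₀ x₀) (comb (valuesAt W (Φ t₀ x₀)) b : E) = hex.choose :=
    dif_pos hex
  -- The chosen curvature vector refers to an unknown frame W'; conjugation of the curvature
  -- matrices carries it over to W.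
  obtain ⟨U', W', H₀', H₁', a, hx', hW', hH', hv, hw⟩ := hex.choose_spec
  rw [← hdef] at hw
  have hF := hB.eventually_isMovingFrameAt hreg ht₀ hinv hS
  obtain ⟨C, -, hC, -, -, hK⟩ := exists_change_of_frame hF
    (hB.eventually_isMovingFrameAt hreg ht₀ hinv ⟨hx', hW', hH'⟩)
  have hC' : ∀ a, comb (valuesAt W' (Φ t₀ x₀)) a = comb (valuesAt W (Φ t₀ x₀)) (C *ᵥ a) := by
    intro a
    refine pull_injective hinv ?_
    rw [← comb_pullFrame, ← comb_pullFrame]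
    exact hC a
  have hv' : comb (valuesAt W (Φ t₀ x₀)) b = comb (valuesAt W (Φ t₀ x₀)) (C *ᵥ a) := by
    rw [← hC']
    exact hv.trans (comb_apply (F := E) _ _).symm
  have hb : b = C *ᵥ a := by
    have := (hS.frame.eq_zero hreg hS.mem (b - C *ᵥ a) 0 (by
      rw [map_sub, hv', sub_self, map_zero, add_zero])).1
    exact sub_eq_zero.1 this
  refine hw.trans ((comb_apply (F := E) (valuesAt W' (Φ t₀ x₀)) _).symm.trans ?_)
  rw [hC', hb, Matrix.mulVec_mulVec, Matrix.mulVec_mulVec]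
  exact congrArg (fun A : Matrix (Fin m) (Fin m) ℝ => comb (valuesAt W (Φ t₀ x₀)) (A *ᵥ a)) hK.symm

end IsFlowBox

end Trajectory

/-! ### Conjugate times on the manifold -/

section Conjugate

variable {E : Type*} [NormedAddCommGroup E] [NormedSpace ℝ E]
  {M : Type*} [TopologicalSpace M] [ChartedSpace E M] [IsManifold 𝓘(ℝ, E) ∞ M]
  {m : ℕ} {X : VField E M} {V : PlaneField E M} {Φ : ℝ → M → M} {J : Set ℝ} {N : Set M}
  {c : ℝ → M} {T τ : ℝ}

theorem curvature_le_iff {g : ∀ t : ℝ, LinearMap.BilinForm ℝ (TangentSpace 𝓘(ℝ, E) (c t))}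
    (hg : IsInvariantMetric X V c T g) (lam : ℝ) :
    (∀ t ∈ Icc 0 T, ∀ v ∈ V (c t), g t (curvature m X V (c t) v) v ≤ lam * g t v v) ↔
      ∀ t ∈ Icc 0 T, ∀ v ∈ V (c t), v ≠ 0 → directionalCurvature m X V c g t v ≤ lam := by
  constructor
  · intro h t ht v hv hv0
    exact (div_le_iff₀ (hg.pos t ht v hv hv0)).2 (h t ht v hv)
  · intro h t ht v hv
    by_cases hv0 : v = 0
    · rw [hv0, map_zero, map_zero, mul_zero]
    · exact (div_le_iff₀ (hg.pos t ht v hv hv0)).1 (h t ht v hv hv0)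

variable [FiniteDimensional ℝ E] [T2Space M]

/-- The flow line through `c 0` is the integral curve `c`. -/
theorem IsFlowBox.eqOn_integralCurve (hB : IsFlowBox X Φ J N (c 0))
    (hc : IsMIntegralCurveOn c X (Icc 0 T)) (hτ : 0 < τ) (hτT : τ ≤ T) (hJ : Icc 0 τ ⊆ J) :
    EqOn (fun t => Φ t (c 0)) c (Icc 0 τ) := by
  have hcomplete : CompleteSpace E := FiniteDimensional.complete ℝ E
  have h0 : (0 : ℝ) ∈ J := hJ ⟨le_rfl, hτ.le⟩
  have hinit : Φ 0 (c 0) = c 0 := hB.initial _ hB.mem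
  obtain ⟨ε, hε, hεJ⟩ := Metric.mem_nhds_iff.1 (hB.isOpen_times.mem_nhds h0)
  rw [Real.ball_eq_Ioo] at hεJ
  -- Uniqueness of integral curves is used on an open interval around 0, while c is given on [0,T]
  -- only. So c is prolonged to negative times by the flow line; at 0 the one-sided derivatives
  -- agree.
  let γ : ℝ → M := fun t => if t < 0 then Φ t (c 0) else c t
  have hγ₀ : γ 0 = c 0 := if_neg (lt_irrefl _)
  have hγΦ : ∀ t ≤ 0, γ t = Φ t (c 0) := by
    intro t ht
    rcases ht.lt_or_eq with h | h
    · exact if_pos h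
    · rw [h, hγ₀, hinit]
  have hγc : ∀ t, 0 ≤ t → γ t = c t := fun t ht => if_neg ht.not_gt
  have hγ : IsMIntegralCurveOn γ X (Ioo (-ε) τ) := by
    intro t ht
    refine HasMFDerivAt.hasMFDerivWithinAt ?_
    rcases lt_trichotomy t 0 with h | h | h
    · have htJ : t ∈ J := hεJ ⟨by linarith [ht.1], by linarith⟩
      rw [hγΦ t h.le]
      refine (hB.hasMFDerivAt htJ).congr_of_eventuallyEq ?_
      filter_upwards [Iio_mem_nhds h] with s hs using hγΦ s (le_of_lt hs)
    · subst h
      have h1 : HasMFDerivWithinAt 𝓘(ℝ, ℝ) 𝓘(ℝ, E) γ (Iic 0) 0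
          ((1 : ℝ →L[ℝ] ℝ).smulRight (X (γ 0))) := by
        rw [hγΦ 0 le_rfl]
        exact (hB.hasMFDerivAt h0).hasMFDerivWithinAt.congr_of_eventuallyEq
          (eventually_mem_nhdsWithin.mono fun s hs => hγΦ s hs) (hγΦ 0 le_rfl)
      have h2 : HasMFDerivWithinAt 𝓘(ℝ, ℝ) 𝓘(ℝ, E) γ (Icc 0 T) 0
          ((1 : ℝ →L[ℝ] ℝ).smulRight (X (γ 0))) := by
        rw [hγ₀]
        exact (hc 0 ⟨le_rfl, hτ.le.trans hτT⟩).congr_of_eventuallyEq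
          (eventually_mem_nhdsWithin.mono fun s hs => hγc s hs.1) hγ₀
      refine (h1.union h2).hasMFDerivAt ?_
      filter_upwards [Iio_mem_nhds (hτ.trans_le hτT)] with s hs
      rcases le_total s 0 with h | h
      · exact Or.inl h
      · exact Or.inr ⟨h, le_of_lt hs⟩
    · rw [hγc t h.le]
      refine ((hc t ⟨h.le, ht.2.le.trans hτT⟩).hasMFDerivAt
        (Icc_mem_nhds h (ht.2.trans_le hτT))).congr_of_eventuallyEq ?_
      filter_upwards [Ioi_mem_nhds h] with s hs using hγc s (le_of_lt hs)
  have hΦ : IsMIntegralCurveOn (fun t => Φ t (c 0)) X (Ioo (-ε) τ) := by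
    intro t ht
    refine (hB.hasMFDerivAt ?_).hasMFDerivWithinAt
    rcases lt_or_ge t 0 with h | h
    · exact hεJ ⟨by linarith [ht.1], by linarith⟩
    · exact hJ ⟨h, ht.2.le⟩
  have hX : ContMDiff 𝓘(ℝ, E) 𝓘(ℝ, E).tangent 1
      (fun x => (⟨x, X x⟩ : TangentBundle 𝓘(ℝ, E) M)) :=
    fun x => (hB.smooth_field x).of_le (WithTop.coe_le_coe.2 le_top)
  have : IsManifold 𝓘(ℝ, E) 1 M := IsManifold.of_le (n := ∞) (WithTop.coe_le_coe.2 le_top)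
  have heq := isMIntegralCurveOn_Ioo_eqOn_of_contMDiff_boundaryless (t₀ := 0)
    ⟨neg_lt_zero.2 hε, hτ⟩ hX hΦ hγ (hinit.trans hγ₀.symm)
  have heq' : EqOn (fun t => Φ t (c 0)) c (Ioo 0 τ) := fun t ht =>
    (heq ⟨(neg_lt_zero.2 hε).trans ht.1, ht.2⟩).trans (hγc t ht.1.le)
  refine heq'.of_subset_closure (fun t ht => (hB.continuousAt (hJ ht)).continuousWithinAt)
    (fun t ht => ((hc t ⟨ht.1, ht.2.trans hτT⟩).continuousWithinAt).mono
      (Icc_subset_Icc_right hτT)) Ioo_subset_Icc_self ?_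
  rw [closure_Ioo hτ.ne]

/-- The comparison theorem: a curvature bound excludes conjugate times. -/
theorem not_isConjugateTime (hreg : IsRegularPair m X V)
    (hc : IsMIntegralCurveOn c X (Icc 0 T))
    {g : ∀ t : ℝ, LinearMap.BilinForm ℝ (TangentSpace 𝓘(ℝ, E) (c t))}
    (hg : IsInvariantMetric X V c T g) {lam : ℝ} (hlam : 0 ≤ lam)
    (hK : ∀ t ∈ Icc 0 T, ∀ v ∈ V (c t), g t (curvature m X V (c t) v) v ≤ lam * g t v v)
    (hτ : 0 < τ) (hτT : τ ≤ T) (hlt : √lam * τ < Real.pi) : ¬ IsConjugateTime X V c τ := by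
  rintro ⟨-, Φ, ⟨J, N, hJ, hJτ, hN, hx, hΦ, hflow⟩, hne⟩
  have hB : IsFlowBox X Φ J N (c 0) := ⟨hreg.smoothAt, hJ, hN, hx, hΦ,
    fun y hy => (hflow y hy).1, fun y hy => (hflow y hy).2⟩
  have heq := hB.eqOn_integralCurve hc hτ hτT hJτ
  have hinv : ∀ t ∈ Icc 0 τ, (flowDeriv (E := E) Φ (c 0) t).IsInvertible :=
    fun t ht => hB.isInvertible hJτ ht
  have hsub : Icc 0 τ ⊆ Icc 0 T := Icc_subset_Icc_right hτT
  let F : ℝ → E →ₗ[ℝ] E := fun t => (flowDeriv (E := E) Φ (c 0) t).toLinearMap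
  -- Tangent spaces are by definition copies of E. Forgetting the base point lets Φ t (c 0) be
  -- rewritten as c t.
  let g' : ℝ → LinearMap.BilinForm ℝ E := g
  let P : M → Submodule ℝ E := V
  have hP : ∀ t ∈ Icc 0 τ, ∀ v : E, v ∈ pulledSpace Φ (c 0) V t → F t v ∈ P (c t) := by
    intro t ht v hv
    have h : F t v ∈ P (Φ t (c 0)) := hv
    rwa [show Φ t (c 0) = c t from heq ht] at h
  have hF : ∀ t ∈ Icc 0 τ, ∀ v : E, F t (pull (E := E) Φ (c 0) t v) = v :=
    fun t ht v => (hinv t ht).self_apply_inverse v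
  obtain ⟨v', hv', hv'0⟩ := Submodule.exists_mem_ne_zero_of_ne_bot hne
  obtain ⟨⟨v, hv, rfl⟩, hvτ⟩ := hv'
  refine hv'0 ?_
  suffices h : (v : E) = 0 by
    rw [h]
    exact map_zero (F τ)
  -- The metric is pulled back by the flow differential, and a vector of V(c(0)) whose image at time
  -- τ lies in V is a fixed vector in L(0) and L(τ).
  refine eq_zero_of_mem_endpoints (m := m) (L := pulledSpace Φ (c 0) V)
    (G := fun t => (g' t).comp (F t) (F t)) hτ hlam hlt ?_ ?_ ?_ ?_ hvτ
  · exact fun t ht x hx y hy => hg.symm t (hsub ht) _ (hP t ht x hx) _ (hP t ht y hy)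
  · intro t ht x hx hx0
    refine hg.pos t (hsub ht) _ (hP t ht x hx) fun h => hx0 ?_
    exact (hinv t ht).injective (h.trans (map_zero (F t)).symm)
  · intro t₀ ht₀
    obtain ⟨U, W, H₀, H₁, hS⟩ := hreg.exists_structure (Φ t₀ (c 0))
    have hS : IsStructureFrame X V W H₀ H₁ U (Φ t₀ (c 0)) := ⟨hS.1, hS.2.1, hS.2.2⟩
    have hi := hinv t₀ ht₀
    have hcomb : ∀ a, F t₀ (comb (pullFrame Φ (c 0) W t₀) a) =
        comb (valuesAt W (c t₀)) a := by
      intro a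
      rw [comb_pullFrame, hF t₀ ht₀, show Φ t₀ (c 0) = c t₀ from heq ht₀]
    have hw : ∀ s ∈ Icc 0 τ, ∀ i, F s (pullFrame Φ (c 0) W s i) = valuesAt W (c s) i := by
      intro s hs i
      exact (hF s hs _).trans (congrArg (fun y => valuesAt W y i) (heq hs))
    refine ⟨_, _, _, _, _, hB.eventually_isMovingFrameAt hreg (hJτ ht₀) hi hS, ?_, ?_⟩
    · intro i j
      have hsec : ∀ i, IsLocalSection V (W i) (c t₀) := by
        intro i
        rw [← show Φ t₀ (c 0) = c t₀ from heq ht₀]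
        exact hS.frame.isLocalSection hS.mem i
      have hcov : ∀ i, (covDeriv X V (W i) (c t₀) : E) =
          F t₀ (comb (pullFrame Φ (c 0) W t₀) (((1 / 2 : ℝ) • H₁ (Φ t₀ (c 0))).col i)) := by
        intro i
        rw [comb_pullFrame, hF t₀ ht₀, ← hB.covDeriv_frame hreg (hJτ ht₀) hi hS i]
        exact congrArg (fun y => (covDeriv X V (W i) y : E)) (heq ht₀).symm
      have h1 : HasDerivWithinAt (fun s => g' s (valuesAt W (c s) i) (valuesAt W (c s) j))
          (g' t₀ (covDeriv X V (W i) (c t₀)) (valuesAt W (c t₀) j) +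
            g' t₀ (valuesAt W (c t₀) i) (covDeriv X V (W j) (c t₀))) (Icc 0 τ) t₀ :=
        (hg.invariant t₀ (hsub ht₀) (W i) (W j) (hsec i) (hsec j)).mono hsub
      rw [hcov i, hcov j, ← hw t₀ ht₀ i, ← hw t₀ ht₀ j] at h1
      refine h1.congr_of_mem (fun s hs => ?_) ht₀
      rw [← hw s hs i, ← hw s hs j]
      rfl
    · intro b
      have hmem : (comb (valuesAt W (c t₀)) b : E) ∈ P (c t₀) := by
        rw [← hcomb b]
        refine hP t₀ ht₀ _ ?_
        rw [← range_comb_pullFrame hS.frame hS.mem hi]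
        exact ⟨b, rfl⟩
      have h1 := hK t₀ (hsub ht₀) _ hmem
      have hcurv : (curvature m X V (c t₀) (comb (valuesAt W (c t₀)) b : E) : E) =
          F t₀ (comb (pullFrame Φ (c 0) W t₀)
            (curvatureMatrix X H₀ H₁ (Φ t₀ (c 0)) *ᵥ b)) := by
        rw [comb_pullFrame, hF t₀ ht₀, ← hB.curvature_comb hreg (hJτ ht₀) hi hS b]
        exact congrArg (fun y => (curvature m X V y (comb (valuesAt W y) b : E) : E))
          (heq ht₀).symm
      have h2 : g' t₀ (curvature m X V (c t₀) (comb (valuesAt W (c t₀)) b : E))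
          (comb (valuesAt W (c t₀)) b) ≤
          lam * g' t₀ (comb (valuesAt W (c t₀)) b) (comb (valuesAt W (c t₀)) b) := h1
      rw [hcurv, ← hcomb b] at h2
      exact h2
  · have h : F 0 v ∈ P (Φ 0 (c 0)) := by
      rw [hB.initial _ hx, show F 0 v = v from DFunLike.congr_fun hB.flowDeriv_zero v]
      exact hv
    exact h

end Conjugate

end DynPair

/-! ### Conclusion for both signs of λ -/

theorem theorem1 {E : Type*} [NormedAddCommGroup E] [NormedSpace ℝ E] [FiniteDimensional ℝ E]
    {M : Type*} [TopologicalSpace M] [T2Space M] [ChartedSpace E M] [IsManifold 𝓘(ℝ, E) ∞ M]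
    (m : ℕ) (X : DynPair.VField E M) (V : DynPair.PlaneField E M)
    (hreg : DynPair.IsRegularPair m X V)
    (T : ℝ) (c : ℝ → M) (hc : IsMIntegralCurveOn c X (Set.Icc 0 T))
    (g : ∀ t : ℝ, LinearMap.BilinForm ℝ (TangentSpace 𝓘(ℝ, E) (c t)))
    (hg : DynPair.IsInvariantMetric X V c T g) (lam : ℝ) :
    ((∀ t ∈ Set.Icc 0 T, ∀ v ∈ V (c t),
        g t (DynPair.curvature m X V (c t) v) v ≤ lam * g t v v) ↔
      (∀ t ∈ Set.Icc 0 T, ∀ v ∈ V (c t), v ≠ 0 →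
        DynPair.directionalCurvature m X V c g t v ≤ lam)) ∧
    ((∀ t ∈ Set.Icc 0 T, ∀ v ∈ V (c t),
        g t (DynPair.curvature m X V (c t) v) v ≤ lam * g t v v) →
      (lam ≤ 0 → ∀ t ∈ Set.Ioc 0 T, ¬ DynPair.IsConjugateTime X V c t) ∧
      (0 < lam → ∀ t ∈ Set.Ioo 0 (min T (Real.pi / Real.sqrt lam)),
        ¬ DynPair.IsConjugateTime X V c t)) := by
  refine ⟨DynPair.curvature_le_iff hg lam, fun h => ⟨fun hlam τ hτ => ?_, fun hlam τ hτ => ?_⟩⟩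
  -- A bound by lam ≤ 0 is also a bound by 0, for which the restriction on the length of the
  -- interval reads 0 < π.
  · refine DynPair.not_isConjugateTime hreg hc hg (le_refl (0 : ℝ)) (fun t ht v hv => ?_) hτ.1 hτ.2
      (by rw [Real.sqrt_zero, zero_mul]; exact Real.pi_pos)
    have hnonneg : 0 ≤ g t v v := by
      by_cases hv0 : v = 0
      · rw [hv0, map_zero]
      · exact (hg.pos t ht v hv hv0).le
    rw [zero_mul]
    exact (h t ht v hv).trans (mul_nonpos_of_nonpos_of_nonneg hlam hnonneg)
  · refine DynPair.not_isConjugateTime hreg hc hg hlam.le h hτ.1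
      (hτ.2.le.trans (min_le_left _ _)) ?_
    rw [mul_comm]
    exact (lt_div_iff₀ (Real.sqrt_pos.2 hlam)).1 (hτ.2.trans_le (min_le_right _ _))
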